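/- Let $k$ be a field. For an essentially small additive category $\mathcal{A}$, let $\mathcal{F}(\mathcal{A};k)$ be the category of all (not necessarily additive) functors from $\mathcal{A}$ to $k$-vector spaces, and let $\mathbf{Rep}(\mathcal{A})$ be the category of additive functors from $\mathcal{A}$ to abelian groups. Call $\mathcal{A}$ \emph{$k$-trivial} if, for all objects $x,y$ of $\mathcal{A}$, the abelian group $\mathcal{A}(x,y)$ is finite and its order is invertible in $k$. Call an abelian category \emph{locally finite} if it is generated by its objects of finite length (i.e. the objects that are both Noetherian and Artinian). If $\mathcal{A}$ is $k$-trivial, then $\mathcal{F}(\mathcal{A};k)$ is locally finite if and only if $\mathbf{Rep}(\mathcal{A})$ is locally finite. In particular, let $R$ be a $k$-trivial ring, i.e. a finite ring whose cardinality is invertible in $k$, let $\mathbf{P}(R)$ be the category of finitely generated projective left $R$-modules, and let $\mathcal{F}(R,k):=\mathcal{F}(\mathbf{P}(R);k)$. Then $\mathcal{F}(R,k)$ is locally finite. -/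

import Mathlib

open CategoryTheory Limits

universe w v u t

namespace GenericRep

/-- An object of finite length: one that is both Noetherian and Artinian. -/
def isFiniteLength (C : Type u) [Category.{v} C] : ObjectProperty C :=
  isNoetherianObject ⊓ isArtinianObject

/-- A category is locally finite if its objects of finite length generate it
(two parallel morphisms that agree after precomposition with every morphism whose source has
finite length are equal). -/
def IsLocallyFinite (C : Type u) [Category.{v} C] : Prop :=
  (isFiniteLength C).IsSeparating

/-- The category of all functors from `A` to `k`-vector spaces. -/
abbrev FunctorCat (A : Type u) [Category.{v} A] (k : Type w) [Field k] :=
  A ⥤ ModuleCat.{w} k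

/-- The category of additive functors from `A` to abelian groups. -/
abbrev Rep (A : Type u) [Category.{v} A] [Preadditive A] :=
  A ⥤+ AddCommGrpCat.{w}

/-- A category is `k`-trivial if every group of morphisms is finite, of order invertible in `k`. -/
def IsKTrivial (A : Type u) [Category.{v} A] [Preadditive A] (k : Type w) [Field k] : Prop :=
  ∀ x y : A, Finite (x ⟶ y) ∧ IsUnit (Nat.card (x ⟶ y) : k)

/-- Finitely generated projective left `R`-modules, as a property of objects of `ModuleCat R`. -/
def isFGProjective (R : Type t) [Ring R] : ObjectProperty (ModuleCat.{t} R) :=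
  fun M ↦ Module.Finite R M ∧ Module.Projective R M

/-- The category of finitely generated projective left `R`-modules. -/
abbrev ProjCat (R : Type t) [Ring R] := (isFGProjective R).FullSubcategory

/-- A ring is `k`-trivial if it is finite, of cardinality invertible in `k`. -/
def IsKTrivialRing (R : Type t) [Ring R] (k : Type w) [Field k] : Prop :=
  Finite R ∧ IsUnit (Nat.card R : k)

/-- A ring `R` is `k`-trivial if and only if its category of finitely generated projective modules
is `k`-trivial. -/
theorem isKTrivialRing_iff (R : Type t) [Ring R] (k : Type w) [Field k] :
    IsKTrivialRing R k ↔ IsKTrivial (ProjCat R) k := by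
  constructor
  · rintro ⟨hf, hu⟩ x y
    have hx : Module.Finite R x.obj := x.property.1
    have hy : Module.Finite R y.obj := y.property.1
    obtain ⟨n, f, hfs⟩ := Module.Finite.exists_fin' R x.obj
    obtain ⟨m, g, hgs⟩ := Module.Finite.exists_fin' R y.obj
    have hfy : Finite y.obj := Finite.of_surjective g hgs
    have hcy : Nat.card y.obj ∣ Nat.card R ^ m := by
      have := AddSubgroup.card_range_dvd g.toAddMonoidHom
      rw [AddMonoidHom.range_eq_top.2 hgs] at this
      simpa [Nat.card_pi] using this
    let φ : (x ⟶ y) →+ (Fin n → y.obj) :=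
      { toFun := fun h i ↦ h.hom.hom (f (Pi.single i 1))
        map_zero' := by ext i; rfl
        map_add' := fun a b ↦ by ext i; rfl }
    have hφ : Function.Injective φ := by
      intro a b hab
      apply ObjectProperty.hom_ext
      apply ModuleCat.hom_ext
      rw [← LinearMap.cancel_right hfs]
      apply LinearMap.pi_ext'
      intro i
      apply LinearMap.ext_ring
      exact congrFun hab i
    have hd : Nat.card (x ⟶ y) ∣ (Nat.card R ^ m) ^ n := by
      refine (AddSubgroup.card_dvd_of_injective φ hφ).trans ?_
      simpa [Nat.card_pi] using pow_dvd_pow_of_dvd hcy n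
    refine ⟨Finite.of_injective φ hφ, ?_⟩
    have h2 : IsUnit (((Nat.card R ^ m) ^ n : ℕ) : k) := by
      push_cast
      exact (hu.pow m).pow n
    exact isUnit_of_dvd_unit (Nat.cast_dvd_cast hd) h2
  · intro h
    let P : ProjCat R := ⟨ModuleCat.of R R, ⟨inferInstanceAs (Module.Finite R R),
      inferInstanceAs (Module.Projective R R)⟩⟩
    let e : (P ⟶ P) ≃ R :=
      ((InducedCategory.homEquiv).trans ModuleCat.homEquiv).trans
        (LinearMap.ringLmapEquivSelf R ℕ R).toEquiv
    obtain ⟨h1, h2⟩ := h P P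
    refine ⟨Finite.of_equiv _ e, ?_⟩
    rwa [← Nat.card_congr e]

end GenericRep

/-! The functors `k[A(x,-)]` and `A(x,-)` are each generated by one element, and their maps to a
functor of their category pick out arbitrary elements of its value at `x`. So either category is
locally finite exactly when these functors have finite length, and the theorem compares their
lattices of subfunctors.

Sending a subfunctor `N` of `A(x,-)` to `k[N]` is strictly monotone, so finite length of `k[A(x,-)]`
gives that of `A(x,-)`. Conversely, finite length of `A(x,-)` yields an object `t` such that every
`u : x ⟶ y` is fixed by a sum of endomorphisms of `y` factoring through `t`
(`exists_factorization_object`). Seen from `x`, every object is then a retract of a power of `t`,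
and it remains to bound the exponent: subfunctors of `k[A(x,-)]` are determined by their value at
one large power of `t` (`exists_test_object`), a subspace of a finite-dimensional space.

The bound is an algebraic fact. Put `R = End t` and `N = A(x,t)`; the monoid algebra of square
matrices over `R` acts on `k[N^ι]`. For large `ι`, an element of the ideal generated by the matrices
erasing a coordinate acts as the identity (`exists_identity_mem_singIdeal`), so a power of `t` is
controlled by powers with one factor fewer. The proof is by induction on submodules `p` of `N`. In
the quotient of the monoid algebra by this ideal and by the annihilator of `k[p^ι]`, averages of
transvections (which exist because the order of `R` is invertible in `k`) become `1`
(`map_avgAdd_erase_eq_one`). Since a long tuple has two equal entries, this forces `1 = 0` there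
(`subsingleton_of_averages_trivial`).

For finitely generated projective modules, `t = R` serves every `x`, because such a module is a
retract of some `R^n`. -/

namespace GenericRep

open scoped Matrix.Module

/-! ### Monoid algebras acting on free vector spaces. -/

section LinearizedAction

variable (k : Type*) [Field k] (G : Type*) [Monoid G] (H : Type*) [MulAction G H]

/-- The monoid algebra of `G` acts on the free vector space on a `G`-set. -/
noncomputable def linAct : MonoidAlgebra k G →ₐ[k] Module.End k (H →₀ k) :=
  MonoidAlgebra.lift k (Module.End k (H →₀ k)) G
    { toFun := fun g ↦ Finsupp.lmapDomain k k (g • ·)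
      map_one' := by ext; simp
      map_mul' := fun a b ↦ by ext; simp [mul_smul] }

variable {k G H}

@[simp]
theorem linAct_of_single (g : G) (m : H) (r : k) :
    linAct k G H (MonoidAlgebra.of k G g) (Finsupp.single m r) = Finsupp.single (g • m) r := by
  simp [linAct]

/-- An element of the monoid algebra that kills all elements of a set `S` of basis vectors kills
every vector supported on `S`. -/
theorem linAct_eq_zero_of_supported {X : MonoidAlgebra k G} {S : Set H}
    (hX : ∀ m ∈ S, linAct k G H X (Finsupp.single m 1) = 0) {v : H →₀ k}
    (hv : v ∈ Finsupp.supported k k S) : linAct k G H X v = 0 := by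
  have h : Finsupp.supported k k S ≤ LinearMap.ker (linAct k G H X) := by
    rw [Finsupp.supported_eq_span_single, Submodule.span_le]
    rintro _ ⟨m, hm, rfl⟩
    exact hX m hm
  exact h hv

/-- A subset stable under `G` spans a stable subspace. -/
theorem linAct_mem_supported {S : Set H} (hS : ∀ (g : G), ∀ m ∈ S, g • m ∈ S)
    (X : MonoidAlgebra k G) {v : H →₀ k} (hv : v ∈ Finsupp.supported k k S) :
    linAct k G H X v ∈ Finsupp.supported k k S := by
  induction X using MonoidAlgebra.induction_on with
  | of g =>
    have h : Finsupp.supported k k S ≤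
        (Finsupp.supported k k S).comap (linAct k G H (MonoidAlgebra.of k G g)) := by
      conv_lhs => rw [Finsupp.supported_eq_span_single]
      rw [Submodule.span_le]
      rintro _ ⟨m, hm, rfl⟩
      rw [SetLike.mem_coe, Submodule.mem_comap, linAct_of_single]
      exact Finsupp.single_mem_supported k (1 : k) (hS g m hm)
    exact h hv
  | add x y hx hy => simpa using add_mem hx hy
  | smul r x hx => simpa using Submodule.smul_mem _ r hx

/-- Elements of the monoid algebra killing a `G`-stable set of basis vectors. -/
noncomputable def annIdeal (k : Type*) [Field k] {G : Type*} [Monoid G] {H : Type*} [MulAction G H]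
    (S : Set H) (hS : ∀ (g : G), ∀ m ∈ S, g • m ∈ S) : TwoSidedIdeal (MonoidAlgebra k G) :=
  .mk' {X | ∀ m ∈ S, linAct k G H X (Finsupp.single m 1) = 0}
    (by simp) (fun hx hy m hm ↦ by simp [hx m hm, hy m hm]) (fun hx m hm ↦ by simp [hx m hm])
    (fun hy m hm ↦ by simp [hy m hm])
    (fun {x y} hx m hm ↦ by
      rw [map_mul, Module.End.mul_apply]
      exact linAct_eq_zero_of_supported hx
        (linAct_mem_supported hS y (Finsupp.single_mem_supported k (1 : k) hm)))

theorem mem_annIdeal {S : Set H} {hS : ∀ (g : G), ∀ m ∈ S, g • m ∈ S} {X : MonoidAlgebra k G} :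
    X ∈ annIdeal k S hS ↔ ∀ m ∈ S, linAct k G H X (Finsupp.single m 1) = 0 := by
  simp [annIdeal]

end LinearizedAction

/-! ### Coordinate-erasing matrices, averaged transvections, extension by the identity. -/

section Matrices

variable (k : Type*) [Field k] {R : Type*} [Ring R] {N : Type*} [AddCommGroup N] [Module R N]
  {ι : Type*} [Fintype ι] [DecidableEq ι]

/-- The diagonal matrix that erases the coordinate `j`. -/
def eraseCoord (R : Type*) [Ring R] (j : ι) : Matrix ι ι R :=
  Matrix.diagonal fun i ↦ if i = j then 0 else 1

theorem eraseCoord_smul (j : ι) (m : ι → N) :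
    eraseCoord R j • m = Function.update m j 0 := by
  ext i
  rw [Matrix.Module.smul_apply, Finset.sum_eq_single i]
  · by_cases h : i = j
    · subst h; simp [eraseCoord]
    · simp [eraseCoord, h]
  · intro l _ hl
    simp [eraseCoord, Matrix.diagonal_apply_ne _ hl.symm]
  · simp

/-- The two-sided ideal of the monoid algebra of square matrices generated by the matrices erasing
one coordinate. -/
noncomputable def singIdeal (k : Type*) [Field k] (R : Type*) [Ring R] (ι : Type*)
    [Fintype ι] [DecidableEq ι] :
    TwoSidedIdeal (MonoidAlgebra k (Matrix ι ι R)) :=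
  .span (Set.range fun j ↦ MonoidAlgebra.of k _ (eraseCoord R j))

theorem map_eq_zero_of_mem_singIdeal {Q : Type*} [Ring Q]
    (q : MonoidAlgebra k (Matrix ι ι R) →+* Q)
    (hq : ∀ j, q (MonoidAlgebra.of k _ (eraseCoord R j)) = 0)
    {X : MonoidAlgebra k (Matrix ι ι R)} (hX : X ∈ singIdeal k R ι) : q X = 0 := by
  have : singIdeal k R ι ≤ TwoSidedIdeal.ker q := by
    rw [singIdeal, TwoSidedIdeal.span_le]
    rintro _ ⟨j, rfl⟩
    exact (TwoSidedIdeal.mem_ker _).2 (hq j)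
  exact (TwoSidedIdeal.mem_ker _).1 (this hX)

/-- The square matrix adding a combination with coefficients `α` of the coordinates to the
coordinate `t`. -/
def addToCoord (t : ι) (α : ι → R) : Matrix ι ι R :=
  1 + Matrix.of fun i j ↦ if i = t then α j else 0

theorem addToCoord_smul (t : ι) (α : ι → R) (m : ι → N) :
    addToCoord t α • m = Function.update m t (m t + ∑ j, α j • m j) := by
  rw [addToCoord, add_smul, one_smul]
  ext i
  by_cases h : i = t
  · subst h; simp
  · simp [h]

/-- The linear form `m ↦ ∑ i ∈ T, γ i • (u • m) i`. -/
def coordForm (T : Finset ι) (u : Matrix ι ι R) (γ : ι → R) (m : ι → N) : N :=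
  ∑ i ∈ T, γ i • (u • m) i

/-- The average of the matrices adding to the coordinate `t` the combinations of the coordinates in
`T`, after the change of coordinates `u`. -/
noncomputable def avgAdd [Fintype R] (t : ι) (T : Finset ι) (u : Matrix ι ι R) :
    MonoidAlgebra k (Matrix ι ι R) :=
  -- The coefficients are indexed by all of `ι`, so the normalizing constant does not depend on `T`;
  -- entries of `γ` outside `T` only repeat terms.
  ((Fintype.card (ι → R) : k)⁻¹) • ∑ γ : ι → R,
    MonoidAlgebra.of k _ (addToCoord t fun j ↦ ∑ i ∈ T, γ i * u i j)

variable {k}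

theorem coordForm_update {t : ι} {T : Finset ι} {u : Matrix ι ι R} (hu : ∀ i ∈ T, u i t = 0)
    (γ : ι → R) (m : ι → N) (x : N) :
    coordForm T u γ (Function.update m t x) = coordForm T u γ m := by
  refine Finset.sum_congr rfl fun i hi ↦ ?_
  congr 1
  refine Finset.sum_congr rfl fun j _ ↦ ?_
  by_cases h : j = t
  · subst h; simp [hu i hi]
  · simp [h]

theorem coordForm_add (T : Finset ι) (u : Matrix ι ι R) (γ γ' : ι → R) (m : ι → N) :
    coordForm T u (γ + γ') m = coordForm T u γ m + coordForm T u γ' m := by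
  simp [coordForm, add_smul, Finset.sum_add_distrib]

theorem linAct_avgAdd [Fintype R] (t : ι) (T : Finset ι) (u : Matrix ι ι R) (m : ι → N) :
    linAct k _ _ (avgAdd k t T u) (Finsupp.single m 1) = ((Fintype.card (ι → R) : k)⁻¹) •
      ∑ γ : ι → R, Finsupp.single (Function.update m t (m t + coordForm T u γ m)) 1 := by
  rw [avgAdd, map_smul, map_sum, LinearMap.smul_apply, LinearMap.sum_apply]
  congr 1
  refine Finset.sum_congr rfl fun γ _ ↦ ?_
  rw [linAct_of_single, addToCoord_smul]
  congr 3
  simp only [coordForm, Matrix.Module.smul_apply, Finset.smul_sum, Finset.sum_smul, mul_smul]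
  rw [Finset.sum_comm]

/-- The coefficient vectors form a group, so a shift by `γ₀` merely reindexes the sum. The
hypothesis `hu` makes the added combination independent of coordinate `t`, hence unaffected by the
update. -/
theorem linAct_avgAdd_update [Fintype R] {t : ι} {T : Finset ι} {u : Matrix ι ι R}
    (hu : ∀ i ∈ T, u i t = 0) (γ₀ : ι → R) (m : ι → N) :
    linAct k _ _ (avgAdd k t T u)
      (Finsupp.single (Function.update m t (m t + coordForm T u γ₀ m)) 1) =
    linAct k _ _ (avgAdd k t T u) (Finsupp.single m 1) := by
  rw [linAct_avgAdd, linAct_avgAdd]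
  congr 1
  refine (Equiv.sum_comp (Equiv.addLeft γ₀) _).symm.trans ?_ |>.symm
  refine Finset.sum_congr rfl fun γ _ ↦ ?_
  rw [coordForm_update hu, Function.update_idem, Function.update_self, Equiv.coe_addLeft,
    coordForm_add, add_assoc]

/-- An element fixing the images of a basis vector under all terms of an average has the same value
on the average. -/
theorem linAct_linAct_avgAdd [Fintype R] (hR : (Fintype.card R : k) ≠ 0)
    {t : ι} {T : Finset ι} {u : Matrix ι ι R} {V : Type*} [AddCommGroup V] [Module k V]
    (f : ((ι → N) →₀ k) →ₗ[k] V) (m : ι → N) (v : V)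
    (h : ∀ γ, f (Finsupp.single (Function.update m t (m t + coordForm T u γ m)) 1) = v) :
    f (linAct k _ _ (avgAdd k t T u) (Finsupp.single m 1)) = v := by
  have hc : (Fintype.card (ι → R) : k) ≠ 0 := by simp [hR]
  rw [linAct_avgAdd, map_smul, map_sum, Finset.sum_congr rfl fun γ _ ↦ h γ, Finset.sum_const,
    Finset.card_univ, ← Nat.cast_smul_eq_nsmul k, smul_smul, inv_mul_cancel₀ hc, one_smul]

/-- Extension of a matrix with indices in `T` by the identity. -/
def extendMatrix (T : Finset ι) : Matrix T T R →* Matrix ι ι R where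
  toFun a := (Matrix.fromBlocks a 0 0 (1 : Matrix {i // i ∉ T} {i // i ∉ T} R)).submatrix
    (Equiv.sumCompl (· ∈ T)).symm (Equiv.sumCompl (· ∈ T)).symm
  map_one' := by
    rw [Matrix.fromBlocks_one, Matrix.submatrix_one_equiv]
  map_mul' a b := by
    rw [Matrix.submatrix_mul_equiv, Matrix.fromBlocks_multiply]
    simp

theorem extendMatrix_smul (T : Finset ι) (a : Matrix T T R) (m : ι → N) (i : ι) :
    (extendMatrix T a • m) i = if h : i ∈ T then (a • fun l : T ↦ m l) ⟨i, h⟩ else m i := by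
  rw [Matrix.Module.smul_apply]
  refine (Equiv.sum_comp (Equiv.sumCompl (· ∈ T)) _).symm.trans ?_
  rw [Fintype.sum_sum_type]
  by_cases h : i ∈ T
  · simp [extendMatrix, h, Equiv.sumCompl_symm_apply_of_pos]
  · rw [dif_neg h, Fintype.sum_eq_zero, zero_add, Fintype.sum_eq_single ⟨i, h⟩]
    · simp [extendMatrix, h, Equiv.sumCompl_symm_apply_of_neg]
    · intro x hx
      simp [extendMatrix, h, Equiv.sumCompl_symm_apply_of_neg, Matrix.one_apply_ne hx.symm]
    · intro x
      simp [extendMatrix, h, Equiv.sumCompl_symm_apply_of_neg]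

theorem extendMatrix_eraseCoord (T : Finset ι) (j : T) :
    extendMatrix T (eraseCoord R j) = eraseCoord R (j : ι) := by
  ext i l
  simp only [extendMatrix, MonoidHom.coe_mk, OneHom.coe_mk, Matrix.submatrix_apply]
  by_cases hi : i ∈ T <;> by_cases hl : l ∈ T
  · by_cases hil : i = l
    · subst hil
      have : ((⟨i, hi⟩ : T) = j) ↔ i = j := Subtype.ext_iff
      simp [hi, eraseCoord, this]
    · have : (⟨i, hi⟩ : T) ≠ ⟨l, hl⟩ := fun h ↦ hil (Subtype.ext_iff.1 h)
      simp [hi, hl, eraseCoord, Matrix.diagonal_apply_ne _ hil, Matrix.diagonal_apply_ne _ this]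
  · have : i ≠ l := fun h ↦ hl (h ▸ hi)
    simp [hi, hl, eraseCoord, this]
  · have : i ≠ l := fun h ↦ hi (h ▸ hl)
    simp [hi, hl, eraseCoord, this]
  · have : i ≠ j := fun h ↦ hi (h ▸ j.2)
    simp [hi, hl, eraseCoord, Matrix.diagonal_apply, this, Matrix.one_apply]

/-- If `X` fixes the basis vectors of a set of tuples indexed by `T`, then its extension fixes the
tuples restricting to this set. -/
theorem linAct_extendMatrix (T : Finset ι) (X : MonoidAlgebra k (Matrix T T R)) (m : ι → N)
    (hX : linAct k _ _ X (Finsupp.single (fun l : T ↦ m l) 1) =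
      Finsupp.single (fun l : T ↦ m l) 1) :
    linAct k _ _ (MonoidAlgebra.mapDomainRingHom k (extendMatrix T) X) (Finsupp.single m 1) =
      Finsupp.single m 1 := by
  classical
  let g : (T → N) → (ι → N) := fun x i ↦ if h : i ∈ T then x ⟨i, h⟩ else m i
  have key : ∀ Y : MonoidAlgebra k (Matrix T T R),
      linAct k _ _ (MonoidAlgebra.mapDomainRingHom k (extendMatrix T) Y) (Finsupp.single m 1) =
        Finsupp.lmapDomain k k g (linAct k _ _ Y (Finsupp.single (fun l : T ↦ m l) 1)) := by
    intro Y
    induction Y using MonoidAlgebra.induction_on with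
    | of a =>
      have : MonoidAlgebra.mapDomainRingHom k (extendMatrix T) (MonoidAlgebra.of k _ a) =
          MonoidAlgebra.of k _ (extendMatrix T a) := by simp
      rw [this, linAct_of_single, linAct_of_single, Finsupp.lmapDomain_apply,
        Finsupp.mapDomain_single]
      congr 1
      ext i
      exact extendMatrix_smul T a m i
    | add x y hx hy => simp only [map_add, LinearMap.add_apply, hx, hy]
    | smul r x hx =>
      have : MonoidAlgebra.mapDomainRingHom k (extendMatrix T) (r • x) =
          r • MonoidAlgebra.mapDomainRingHom k (extendMatrix T) x := by
        simp [MonoidAlgebra.mapDomain_smul]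
      rw [this, map_smul, map_smul, LinearMap.smul_apply, LinearMap.smul_apply, hx, map_smul]
  rw [key, hX, Finsupp.lmapDomain_apply, Finsupp.mapDomain_single]
  congr 1
  ext i
  simp [g]

end Matrices

/-! ### An element of the singular ideal acting as the identity. -/

section Identity

variable {k : Type*} [Field k] {R : Type*} [Ring R]
  {N : Type*} [AddCommGroup N] [Module R N] {ι : Type*} [Fintype ι] [DecidableEq ι]

theorem coordForm_mem {p : Submodule R N} {m : ι → N} (hm : ∀ i, m i ∈ p) (T : Finset ι)
    (u : Matrix ι ι R) (γ : ι → R) : coordForm T u γ m ∈ p :=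
  Submodule.sum_mem _ fun i _ ↦ p.smul_mem _
    (by rw [Matrix.Module.smul_apply]; exact Submodule.sum_mem _ fun j _ ↦ p.smul_mem _ (hm j))

theorem exists_coordForm_eq {T : Finset ι} {u : Matrix ι ι R} {m : ι → N} {x : N}
    (hx : x ∈ Submodule.span R ((u • m) '' T)) : ∃ γ, coordForm T u γ m = x := by
  classical
  obtain ⟨c, hc⟩ := (Submodule.mem_span_image_finset_iff_exists_fun R).1 hx
  refine ⟨fun i ↦ if h : i ∈ T then c ⟨i, h⟩ else 0, ?_⟩
  rw [← hc, coordForm, ← Finset.sum_coe_sort]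
  refine Finset.sum_congr rfl fun i _ ↦ ?_
  simp

/-- In a quotient of the monoid algebra where the matrices erasing a coordinate vanish, averages
over many coordinates absorb the full average. -/
theorem map_avgAdd_mul_eq_zero [Fintype R] (hR : (Fintype.card R : k) ≠ 0) (p : Submodule R N)
    {Q : Type*} [Ring Q] (q : MonoidAlgebra k (Matrix ι ι R) →+* Q)
    (hq : ∀ j, q (MonoidAlgebra.of k _ (eraseCoord R j)) = 0)
    (hp : ∀ X, (∀ m : ι → N, (∀ i, m i ∈ p) → linAct k _ _ X (Finsupp.single m 1) = 0) → q X = 0)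
    (t : ι) (T : Finset ι) (X : MonoidAlgebra k (Matrix T T R)) (hX : X ∈ singIdeal k R T)
    (hXp : ∀ p' < p, ∀ m : T → N, (∀ i, m i ∈ p') →
      linAct k _ _ X (Finsupp.single m 1) = Finsupp.single m 1)
    (u u' : Matrix ι ι R) (huu' : u' * u = 1) (hu : ∀ i ∈ T, u i t = 0) :
    q (avgAdd k t T u) * q (1 - avgAdd k t (Finset.univ.erase t) 1) = 0 := by
  -- `Y` is `X` acting on the coordinates in `T` after the change of coordinates `u`. Extension by
  -- the identity turns erasing matrices into erasing matrices, so `q` kills `Y`.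
  set Y : MonoidAlgebra k (Matrix ι ι R) := MonoidAlgebra.of k _ u' *
    MonoidAlgebra.mapDomainRingHom k (extendMatrix T) X * MonoidAlgebra.of k _ u with hY
  have hqY : q Y = 0 := by
    have : (q.comp (MonoidAlgebra.mapDomainRingHom k (extendMatrix T))) X = 0 := by
      refine map_eq_zero_of_mem_singIdeal k _ (fun j ↦ ?_) hX
      have : MonoidAlgebra.mapDomainRingHom k (extendMatrix T)
          (MonoidAlgebra.of k _ (eraseCoord R j)) =
          MonoidAlgebra.of k _ (extendMatrix T (eraseCoord R j)) := by simp
      rw [RingHom.comp_apply, this, extendMatrix_eraseCoord, hq]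
    rw [RingHom.comp_apply] at this
    rw [hY, map_mul, map_mul, this, mul_zero, zero_mul]
  have key : q ((1 - Y) * (avgAdd k t T u * (1 - avgAdd k t (Finset.univ.erase t) 1))) = 0 := by
    refine hp _ fun m hm ↦ ?_
    rw [map_mul, Module.End.mul_apply, map_mul, Module.End.mul_apply,
      map_sub (linAct k _ _) 1 (avgAdd k t _ _), map_one, LinearMap.sub_apply, Module.End.one_apply,
      map_sub (linAct k _ _ (avgAdd k t T u))]
    have hle : Submodule.span R ((u • m) '' (T : Set ι)) ≤ p := by
      rw [Submodule.span_le]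
      rintro _ ⟨i, _, rfl⟩
      rw [SetLike.mem_coe, Matrix.Module.smul_apply]
      exact Submodule.sum_mem _ fun j _ ↦ p.smul_mem _ (hm j)
    -- Either the `T`-coordinates of `u • m` span less than `p`, and `Y` fixes `m` whatever its
    -- coordinate `t`; or they span `p`, and the average over `T` already absorbs every combination
    -- occurring in the full average.
    rcases hle.lt_or_eq with hlt | heq
    · have hfix : ∀ x : N, linAct k _ _ (1 - Y) (Finsupp.single (Function.update m t x) 1) = 0 := by
        intro x
        have hT : ∀ i : T, (u • Function.update m t x) i = (u • m) i := by
          intro i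
          refine Finset.sum_congr rfl fun j _ ↦ ?_
          by_cases h : j = t
          · subst h; simp [hu i i.2]
          · simp [h]
        rw [map_sub, map_one, LinearMap.sub_apply, Module.End.one_apply, hY, map_mul, map_mul,
          Module.End.mul_apply, Module.End.mul_apply, linAct_of_single, linAct_extendMatrix,
          linAct_of_single, ← mul_smul, huu', one_smul, sub_self]
        refine hXp _ hlt _ fun i ↦ ?_
        rw [hT]
        exact Submodule.subset_span ⟨i, i.2, rfl⟩
      rw [map_sub (linAct k _ _ (1 - Y)), linAct_linAct_avgAdd hR _ m 0 fun γ ↦ hfix _, zero_sub,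
        neg_eq_zero, ← LinearMap.comp_apply]
      refine linAct_linAct_avgAdd hR _ m 0 fun γ ↦ ?_
      rw [LinearMap.comp_apply]
      refine linAct_linAct_avgAdd hR _ _ 0 fun γ' ↦ ?_
      rw [Function.update_idem]
      exact hfix _
    · rw [linAct_linAct_avgAdd hR (linAct k _ _ (avgAdd k t T u)) m
        (linAct k _ _ (avgAdd k t T u) (Finsupp.single m 1)), sub_self, map_zero]
      intro γ
      obtain ⟨γ', hγ'⟩ := exists_coordForm_eq (heq.ge (coordForm_mem hm _ _ γ))
      rw [← hγ', linAct_avgAdd_update hu]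
  rw [map_mul, map_sub, map_one, hqY, sub_zero, one_mul, map_mul] at key
  exact key

/-- By the pigeonhole principle, after a change of coordinates many coordinates of a tuple
vanish. -/
theorem exists_vanishing_coords [Fintype N] (t : ι) (n : ℕ)
    (hn : n + Fintype.card N + 1 ≤ Fintype.card ι) (m : ι → N) :
    ∃ (T : Finset ι) (u u' : Matrix ι ι R), n ≤ T.card ∧ u' * u = 1 ∧ (∀ i ∈ T, u i t = 0) ∧
      ∀ i ∈ T, (u • m) i = 0 := by
  classical
  -- `r` chooses, for each value taken away from `t`, a representative coordinate different from
  -- `t`; the default `t` is irrelevant.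
  have hr : ∃ r : N → ι, ∀ i, i ≠ t → r (m i) ≠ t ∧ m (r (m i)) = m i := by
    refine ⟨fun x ↦ if h : ∃ i, i ≠ t ∧ m i = x then h.choose else t, fun i hi ↦ ?_⟩
    have h : ∃ j, j ≠ t ∧ m j = m i := ⟨i, hi, rfl⟩
    simp only [dif_pos h]
    exact h.choose_spec
  obtain ⟨r, hr⟩ := hr
  let T : Finset ι := Finset.univ.filter fun i ↦ i ≠ t ∧ r (m i) ≠ i
  have hT : ∀ i, i ∈ T ↔ i ≠ t ∧ r (m i) ≠ i := fun i ↦ by simp [T]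
  -- `1 - P` subtracts from each coordinate in `T` its representative, which carries the same value.
  -- Representatives lie outside `T`, so `P * P = 0` and `1 + P` is the inverse.
  let P : Matrix ι ι R := fun i j ↦ if i ∈ T ∧ j = r (m i) then 1 else 0
  have hP : P * P = 0 := by
    ext i l
    rw [Matrix.mul_apply]
    refine Finset.sum_eq_zero fun j _ ↦ ?_
    by_cases hi : i ∈ T ∧ j = r (m i)
    · have : j ∉ T := by
        rw [hT, hi.2, (hr i ((hT i).1 hi.1).1).2]
        simp
      simp [P, this]
    · simp [P, hi]
  refine ⟨T, 1 - P, 1 + P, ?_, ?_, ?_, ?_⟩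
  -- Outside `T` there are only `t` and representatives, at most `Fintype.card N + 1` coordinates in
  -- all.
  · have hsub : (Finset.univ : Finset ι) ⊆ T ∪ insert t (Finset.univ.image r) := by
      intro i _
      by_cases h1 : i = t
      · simp [h1]
      · by_cases h2 : r (m i) = i
        · simp only [Finset.mem_union, Finset.mem_insert, Finset.mem_image]
          exact .inr (.inr ⟨m i, Finset.mem_univ _, h2⟩)
        · exact Finset.mem_union_left _ ((hT i).2 ⟨h1, h2⟩)
    have h1 := Finset.card_le_card hsub
    have h2 := Finset.card_union_le T (insert t (Finset.univ.image r))
    have h3 := Finset.card_insert_le t (Finset.univ.image r)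
    have h4 : (Finset.univ.image r).card ≤ Fintype.card N := Finset.card_image_le
    rw [Finset.card_univ] at h1
    omega
  · rw [add_mul, mul_sub, mul_sub, hP]
    simp
  · intro i hi
    have h := (hT i).1 hi
    have h1 := (hr i h.1).1
    rw [Matrix.sub_apply, Matrix.one_apply_ne h.1]
    simp [P, h1.symm]
  · intro i hi
    have h := (hT i).1 hi
    have h1 : (P • m) i = m i := by
      rw [Matrix.Module.smul_apply, Finset.sum_eq_single (r (m i))]
      · simp [P, hi, (hr i h.1).2]
      · intro j _ hj
        simp [P, hj]
      · simp
    rw [sub_smul, one_smul, Pi.sub_apply, h1, sub_self]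

/-- Write `e` for the full average. Each tuple `m` has a large `T` and a `u` with `u • m` zero on
`T`, so the corresponding average fixes `m`, while `q` of it annihilates `q (1 - e)`. The product of
the factors `1 - avgAdd k t T u` over all tuples thus acts as zero, yet multiplies `q (1 - e)` like
`1`. -/
theorem map_avgAdd_erase_eq_one [Fintype R] [Fintype N] (hR : (Fintype.card R : k) ≠ 0)
    (p : Submodule R N)
    {Q : Type*} [Ring Q] (q : MonoidAlgebra k (Matrix ι ι R) →+* Q)
    (hq : ∀ j, q (MonoidAlgebra.of k _ (eraseCoord R j)) = 0)
    (hp : ∀ X, (∀ m : ι → N, (∀ i, m i ∈ p) → linAct k _ _ X (Finsupp.single m 1) = 0) → q X = 0)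
    (n : ℕ) (hn : n + Fintype.card N + 1 ≤ Fintype.card ι)
    (hX : ∀ T : Finset ι, n ≤ T.card → ∃ X ∈ singIdeal k R T, ∀ p' < p, ∀ m : T → N,
      (∀ i, m i ∈ p') → linAct k _ _ X (Finsupp.single m 1) = Finsupp.single m 1) (t : ι) :
    q (avgAdd k t (Finset.univ.erase t) 1) = 1 := by
  classical
  set e := avgAdd k t (Finset.univ.erase t) (1 : Matrix ι ι R) with he
  -- All updates at `t` are carried along because the later factors move tuples only in coordinate
  -- `t`.
  have key : ∀ S : Finset (ι → N), ∃ B, q B * q (1 - e) = q (1 - e) ∧ ∀ m ∈ S, ∀ x,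
      linAct k _ _ B (Finsupp.single (Function.update m t x) 1) = 0 := by
    intro S
    induction S using Finset.induction_on with
    | empty => exact ⟨1, by simp, by simp⟩
    | insert m S _ ih =>
      obtain ⟨B, hB, hBS⟩ := ih
      obtain ⟨T, u, u', hT, huu', hu, hum⟩ := exists_vanishing_coords (R := R) t n hn m
      obtain ⟨X, hX, hXp⟩ := hX T hT
      have h0 := map_avgAdd_mul_eq_zero hR p q hq hp t T X hX hXp u u' huu' hu
      refine ⟨B * (1 - avgAdd k t T u), ?_, ?_⟩
      · rw [map_mul, map_sub q 1 (avgAdd k t T u), map_one, mul_assoc, sub_mul, one_mul, h0,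
          sub_zero, hB]
      · intro m' hm' x
        rw [map_mul, Module.End.mul_apply, map_sub, map_one, LinearMap.sub_apply,
          Module.End.one_apply]
        rcases Finset.mem_insert.1 hm' with rfl | hm'
        · have h1 := linAct_linAct_avgAdd (k := k) (t := t) (T := T) (u := u) hR LinearMap.id
            (Function.update m' t x) (Finsupp.single (Function.update m' t x) 1) fun γ ↦ by
              rw [coordForm_update hu, coordForm, Finset.sum_eq_zero fun i hi ↦ by
                rw [hum i hi, smul_zero], add_zero, Function.update_eq_self, LinearMap.id_apply]
          rw [LinearMap.id_apply] at h1
          rw [h1, sub_self, map_zero]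
        · rw [map_sub, hBS m' hm', linAct_linAct_avgAdd hR _ _ 0, sub_zero]
          intro γ
          rw [Function.update_idem]
          exact hBS m' hm' _
  obtain ⟨B, hB, hB0⟩ := key Finset.univ
  rw [hp B fun m _ ↦ by simpa using hB0 m (Finset.mem_univ _) (m t), zero_mul, map_sub,
    map_one] at hB
  exact (sub_eq_zero.1 hB.symm).symm

/-- If `m i = m j` with `i ∈ s`, then subtracting `m i` from coordinate `j` erases it, so averaging
over `s` cannot distinguish `m` from `m` with `j` erased. The corresponding difference has image `1`
under `q`, and a product of such differences kills every tuple with a repetition, hence every tuple.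
-/
theorem subsingleton_of_averages_trivial [Fintype R] [Fintype N] (hR : (Fintype.card R : k) ≠ 0)
    (p : Submodule R N) {Q : Type*} [Ring Q] (q : MonoidAlgebra k (Matrix ι ι R) →+* Q)
    (hq : ∀ j, q (MonoidAlgebra.of k _ (eraseCoord R j)) = 0)
    (hp : ∀ X, (∀ m : ι → N, (∀ i, m i ∈ p) → linAct k _ _ X (Finsupp.single m 1) = 0) → q X = 0)
    (hn : Fintype.card N < Fintype.card ι)
    (he : ∀ t, q (avgAdd k t (Finset.univ.erase t) 1) = 1) : (1 : Q) = 0 := by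
  classical
  have hone : ∀ (t : ι) (s : Finset ι), t ∉ s → ∀ i ∈ s, (1 : Matrix ι ι R) i t = 0 :=
    fun t s hts i hi ↦ Matrix.one_apply_ne fun h ↦ hts (h ▸ hi)
  -- The full average absorbs the partial ones: their product acts on tuples in `p` as the full
  -- average does.
  have hes : ∀ (t : ι) (s : Finset ι), t ∉ s → q (avgAdd k t s 1) = 1 := by
    intro t s hts
    have h := hp (avgAdd k t (Finset.univ.erase t) 1 * avgAdd k t s 1 -
      avgAdd k t (Finset.univ.erase t) 1) fun m hm ↦ by
        rw [map_sub, LinearMap.sub_apply, map_mul, Module.End.mul_apply, sub_eq_zero]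
        refine linAct_linAct_avgAdd hR _ m _ fun γ ↦ ?_
        have : coordForm s 1 γ m =
            coordForm (Finset.univ.erase t) (1 : Matrix ι ι R) (fun i ↦ if i ∈ s then γ i else 0)
              m := by
          simp only [coordForm, ite_smul, zero_smul]
          rw [← Finset.sum_filter]
          refine Finset.sum_congr ?_ fun _ _ ↦ rfl
          ext i
          simp only [Finset.mem_filter, Finset.mem_erase, Finset.mem_univ, and_true]
          exact ⟨fun h ↦ ⟨fun h' ↦ hts (h' ▸ h), h⟩, fun h ↦ h.2⟩
        rw [this, linAct_avgAdd_update (hone t _ (by simp))]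
    rw [map_sub, map_mul, he, one_mul, sub_eq_zero] at h
    exact h
  have key : ∀ s : Finset ι, ∃ B, q B = 1 ∧ ∀ m : ι → N, (∃ i ∈ s, ∃ j ∈ s, i ≠ j ∧ m i = m j) →
      linAct k _ _ B (Finsupp.single m 1) = 0 := by
    intro s
    induction s using Finset.induction_on with
    | empty => exact ⟨1, by simp, by simp⟩
    | insert j s hj ih =>
      obtain ⟨B, hB, hBs⟩ := ih
      refine ⟨B * (avgAdd k j s 1 * (1 - MonoidAlgebra.of k _ (eraseCoord R j))), ?_, ?_⟩
      · rw [map_mul, map_mul, map_sub, map_one, hq, hes j s hj, hB, sub_zero, mul_one, mul_one]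
      · intro m hm
        rw [map_mul, Module.End.mul_apply, map_mul, Module.End.mul_apply, map_sub, map_one,
          LinearMap.sub_apply, Module.End.one_apply, linAct_of_single, eraseCoord_smul, map_sub]
        by_cases h : ∃ i ∈ s, m i = m j
        -- The new repetition involves `j`; the coefficient `-1` at `i` replaces `m j` by zero.
        · obtain ⟨i, hi, hij⟩ := h
          have h1 := linAct_avgAdd_update (k := k) (hone j s hj) (Pi.single i (-1)) m
          have h2 : coordForm s (1 : Matrix ι ι R) (Pi.single i (-1)) m = - m j := by
            rw [coordForm, Finset.sum_eq_single i]
            · rw [one_smul, Pi.single_eq_same, neg_one_smul, hij]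
            · intro l _ hl
              simp [hl]
            · simp [hi]
          rw [h2, add_neg_cancel] at h1
          rw [h1, sub_self, map_zero]
        · have hs : ∃ i ∈ s, ∃ l ∈ s, i ≠ l ∧ m i = m l := by
            obtain ⟨i, hi, l, hl, hil, hml⟩ := hm
            rcases Finset.mem_insert.1 hi with hi' | hi'
            · rcases Finset.mem_insert.1 hl with hl' | hl'
              · exact absurd (hi'.trans hl'.symm) hil
              · exact absurd ⟨l, hl', by rw [← hml, hi']⟩ h
            · rcases Finset.mem_insert.1 hl with hl' | hl'
              · exact absurd ⟨i, hi', by rw [hml, hl']⟩ h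
              · exact ⟨i, hi', l, hl', hil, hml⟩
          have hup : ∀ x, linAct k _ _ B (Finsupp.single (Function.update m j x) 1) = 0 := by
            intro x
            obtain ⟨i, hi, l, hl, hil, hml⟩ := hs
            refine hBs _ ⟨i, hi, l, hl, hil, ?_⟩
            have h1 : i ≠ j := fun h ↦ hj (h ▸ hi)
            have h2 : l ≠ j := fun h ↦ hj (h ▸ hl)
            simp [h1, h2, hml]
          rw [map_sub, linAct_linAct_avgAdd hR _ _ 0 fun γ ↦ hup _,
            linAct_linAct_avgAdd hR _ _ 0 fun γ ↦ ?_, sub_zero]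
          rw [Function.update_idem]
          exact hup _
  obtain ⟨B, hB, hB0⟩ := key Finset.univ
  rw [← hB]
  refine hp B fun m _ ↦ hB0 m ?_
  obtain ⟨i, j, hij, h⟩ := Fintype.exists_ne_map_eq_of_card_lt m hn
  exact ⟨i, Finset.mem_univ _, j, Finset.mem_univ _, hij, h⟩

/-- If finitely many sets of tuples are each fixed by an element of the ideal of singular matrices,
then so is their union. -/
theorem exists_common_identity (S : Finset (Submodule R N))
    (h : ∀ p ∈ S, ∃ X ∈ singIdeal k R ι, ∀ m : ι → N, (∀ i, m i ∈ p) →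
      linAct k _ _ X (Finsupp.single m 1) = Finsupp.single m 1) :
    ∃ X ∈ singIdeal k R ι, ∀ p ∈ S, ∀ m : ι → N, (∀ i, m i ∈ p) →
      linAct k _ _ X (Finsupp.single m 1) = Finsupp.single m 1 := by
  classical
  -- `Z` will be a product of factors `1 - X`, one for each submodule.
  suffices ∃ Z, 1 - Z ∈ singIdeal k R ι ∧ ∀ p ∈ S, ∀ m : ι → N, (∀ i, m i ∈ p) →
      linAct k _ _ Z (Finsupp.single m 1) = 0 by
    obtain ⟨Z, hZ, hZ0⟩ := this
    refine ⟨1 - Z, hZ, fun p hp m hm ↦ ?_⟩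
    rw [map_sub, map_one, LinearMap.sub_apply, Module.End.one_apply, hZ0 p hp m hm, sub_zero]
  induction S using Finset.induction_on with
  | empty => exact ⟨1, by simp, by simp⟩
  | insert p S _ ih =>
    obtain ⟨Z, hZ, hZ0⟩ := ih fun p hp ↦ h p (Finset.mem_insert_of_mem hp)
    obtain ⟨X, hX, hXp⟩ := h p (Finset.mem_insert_self _ _)
    refine ⟨Z * (1 - X), ?_, ?_⟩
    · have : 1 - Z * (1 - X) = (1 - Z) + Z * X := by noncomm_ring
      rw [this]
      exact (singIdeal k R ι).add_mem hZ ((singIdeal k R ι).mul_mem_left _ _ hX)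
    · intro p' hp' m hm
      rw [map_mul, Module.End.mul_apply]
      rcases Finset.mem_insert.1 hp' with rfl | hp'
      · rw [map_sub, map_one, LinearMap.sub_apply, Module.End.one_apply, hXp m hm, sub_self,
          map_zero]
      · refine linAct_eq_zero_of_supported (S := {m : ι → N | ∀ i, m i ∈ p'}) (hZ0 p' hp')
          (linAct_mem_supported (fun a m hm i ↦ ?_) _ (Finsupp.single_mem_supported k (1 : k) hm))
        rw [Matrix.Module.smul_apply]
        exact Submodule.sum_mem _ fun j _ ↦ p'.smul_mem _ (hm j)

/-- Allowing an arbitrary submodule `p` makes an induction possible: the proper submodules of `p`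
supply the elements needed on subsets `T` of the coordinates. -/
theorem exists_identity_of_submodule [Fintype R] [Fintype N] (hR : (Fintype.card R : k) ≠ 0)
    (p : Submodule R N) : ∃ n : ℕ, ∀ (ι : Type) [Fintype ι] [DecidableEq ι],
      n ≤ Fintype.card ι → ∃ X ∈ singIdeal k R ι, ∀ m : ι → N, (∀ i, m i ∈ p) →
        linAct k _ _ X (Finsupp.single m 1) = Finsupp.single m 1 := by
  classical
  have hfin : Finite (Submodule R N) :=
    Finite.of_injective (fun p ↦ (p : Set N)) SetLike.coe_injective
  have := Fintype.ofFinite (Submodule R N)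
  induction p using WellFoundedLT.induction with
  | ind p ih =>
    choose! n hn using ih
    -- After losing `t` and at most `Fintype.card N` representatives, enough coordinates remain for
    -- every smaller submodule.
    refine ⟨Finset.univ.sup n + Fintype.card N + 1, fun ι _ _ hι ↦ ?_⟩
    have hX : ∀ T : Finset ι, Finset.univ.sup n ≤ T.card → ∃ X ∈ singIdeal k R T, ∀ p' < p,
        ∀ m : T → N, (∀ i, m i ∈ p') →
          linAct k _ _ X (Finsupp.single m 1) = Finsupp.single m 1 := by
      intro T hT
      obtain ⟨X, hX, hXp⟩ := exists_common_identity (k := k) (ι := T)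
        (Finset.univ.filter (· < p)) fun p' hp' ↦ hn p' (by simpa using hp') T (by
          rw [Fintype.card_coe]
          exact (Finset.le_sup (Finset.mem_univ p')).trans hT)
      exact ⟨X, hX, fun p' hp' ↦ hXp p' (by simpa using hp')⟩
    have hS : ∀ (a : Matrix ι ι R), ∀ m ∈ {m : ι → N | ∀ i, m i ∈ p}, a • m ∈
        {m : ι → N | ∀ i, m i ∈ p} := fun a m hm i ↦ by
      rw [Matrix.Module.smul_apply]
      exact Submodule.sum_mem _ fun j _ ↦ p.smul_mem _ (hm j)
    -- If `1 ∈ J`, then `1 = X + Z` with `X` singular and `Z` killing the tuples in `p`, so `X`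
    -- fixes them.
    let J := singIdeal k R ι ⊔ annIdeal k _ hS
    have hq : ∀ j, J.ringCon.mk' (MonoidAlgebra.of k _ (eraseCoord R j)) = 0 := fun j ↦ by
      rw [← TwoSidedIdeal.mem_ker, TwoSidedIdeal.ker_ringCon_mk']
      exact TwoSidedIdeal.mem_sup_left (TwoSidedIdeal.subset_span ⟨j, rfl⟩)
    have hp : ∀ X, (∀ m : ι → N, (∀ i, m i ∈ p) → linAct k _ _ X (Finsupp.single m 1) = 0) →
        J.ringCon.mk' X = 0 := fun X hX ↦ by
      rw [← TwoSidedIdeal.mem_ker, TwoSidedIdeal.ker_ringCon_mk']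
      exact TwoSidedIdeal.mem_sup_right (mem_annIdeal.2 hX)
    have h1 := subsingleton_of_averages_trivial hR p J.ringCon.mk' hq hp (by omega)
      (map_avgAdd_erase_eq_one hR p J.ringCon.mk' hq hp _ hι hX)
    rw [← map_one J.ringCon.mk', ← TwoSidedIdeal.mem_ker, TwoSidedIdeal.ker_ringCon_mk',
      TwoSidedIdeal.mem_sup] at h1
    obtain ⟨X, hX, Z, hZ, hXZ⟩ := h1
    refine ⟨X, hX, fun m hm ↦ ?_⟩
    rw [eq_sub_of_add_eq hXZ, map_sub, map_one, LinearMap.sub_apply, Module.End.one_apply,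
      mem_annIdeal.1 hZ m hm, sub_zero]

/-- For a finite ring `R` whose order is invertible in `k` and a finite `R`-module `N`, some
combination of singular square matrices of large size acts as the identity on the free vector space
on the tuples of elements of `N`. -/
theorem exists_identity_mem_singIdeal [Fintype R] [Finite N] (hR : (Fintype.card R : k) ≠ 0) :
    ∃ n : ℕ, ∀ (ι : Type) [Fintype ι] [DecidableEq ι], n ≤ Fintype.card ι →
      ∃ X ∈ singIdeal k R ι, linAct k _ (ι → N) X = 1 := by
  have := Fintype.ofFinite N
  obtain ⟨n, hn⟩ := exists_identity_of_submodule (N := N) hR ⊤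
  refine ⟨n, fun ι _ _ hι ↦ ?_⟩
  obtain ⟨X, hX, hX1⟩ := hn ι hι
  refine ⟨X, hX, Finsupp.lhom_ext' fun m ↦ LinearMap.ext_ring ?_⟩
  simpa using hX1 m fun _ ↦ trivial

end Identity

/-! ### Reduction of all objects to one power of `t`. -/

section TestObject

variable {A : Type u} [Category.{v} A] (k : Type w) [Field k]

/-- A family of subspaces of the spaces `k[A(x, y)]` that is stable under postcomposition. -/
def IsStableFamily {x : A} (L : ∀ y : A, Submodule k ((x ⟶ y) →₀ k)) : Prop :=
  ∀ ⦃y z : A⦄ (f : y ⟶ z), ∀ h ∈ L y, Finsupp.mapDomain (· ≫ f) h ∈ L z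

variable {k}

/-- `y` need not be a retract of `b`: only morphisms out of `x` have to be fixed by `i ≫ p`, which
is all that the factorization through `t` provides. -/
theorem le_of_factors {x : A} {L H : ∀ y : A, Submodule k ((x ⟶ y) →₀ k)}
    (hL : IsStableFamily k L) (hH : IsStableFamily k H) {y b : A} (i : y ⟶ b) (p : b ⟶ y)
    (hip : ∀ u : x ⟶ y, u ≫ i ≫ p = u) (hb : H b ≤ L b) : H y ≤ L y := by
  intro h hh
  have := hL p _ (hb (hH i h hh))
  rw [← Finsupp.mapDomain_comp] at this
  convert this
  refine Finsupp.mapDomain_id.symm.trans (congrArg (fun φ ↦ Finsupp.mapDomain φ h) ?_)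
  ext u
  simp [hip]

theorem linAct_mem_of_forall_of_mem {G H : Type*} [Monoid G] [MulAction G H]
    {V : Submodule k (H →₀ k)}
    (hV : ∀ g : G, ∀ v ∈ V, linAct k G H (MonoidAlgebra.of k G g) v ∈ V) (X : MonoidAlgebra k G)
    {v : H →₀ k} (hv : v ∈ V) : linAct k G H X v ∈ V := by
  induction X using MonoidAlgebra.induction_on with
  | of g => exact hV g v hv
  | add x y hx hy => simpa using add_mem hx hy
  | smul r x hx => simpa using Submodule.smul_mem _ r hx

variable [Preadditive A]

/-- If every morphism `x ⟶ y` is fixed by some endomorphism of `y` in the ideal generated by `t`,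
then one such endomorphism fixes all morphisms `x ⟶ y`. -/
theorem exists_common_factorization {x t y : A} [Finite (x ⟶ y)]
    (h : ∀ u : x ⟶ y, ∃ (ι : Type) (_ : Fintype ι) (f : ι → (y ⟶ t)) (g : ι → (t ⟶ y)),
      u ≫ ∑ i, f i ≫ g i = u) :
    ∃ (ι : Type) (_ : Fintype ι) (f : ι → (y ⟶ t)) (g : ι → (t ⟶ y)),
      ∀ u : x ⟶ y, u ≫ ∑ i, f i ≫ g i = u := by
  classical
  have := Fintype.ofFinite (x ⟶ y)
  have key : ∀ s : Finset (x ⟶ y),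
      ∃ (ι : Type) (_ : Fintype ι) (f : ι → (y ⟶ t)) (g : ι → (t ⟶ y)),
        ∀ u ∈ s, u ≫ ∑ i, f i ≫ g i = u := by
    intro s
    induction s using Finset.induction_on with
    | empty => exact ⟨Empty, inferInstance, nofun, nofun, by simp⟩
    | insert u s _ ih =>
      obtain ⟨ι, _, f, g, hs⟩ := ih
      -- With `e` fixing `s` and `e'` fixing the defect `u - u ≫ e`, the endomorphism `e + (𝟙 y - e)
      -- ≫ e'` fixes `u` as well as `s`.
      obtain ⟨ι', _, f', g', hu⟩ := h (u - u ≫ ∑ i, f i ≫ g i)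
      refine ⟨ι ⊕ ι', inferInstance, Sum.elim f fun i ↦ (𝟙 y - ∑ i, f i ≫ g i) ≫ f' i,
        Sum.elim g g', fun u' hu' ↦ ?_⟩
      rw [Fintype.sum_sum_type]
      simp only [Sum.elim_inl, Sum.elim_inr, Category.assoc, ← Preadditive.comp_sum]
      rw [Preadditive.comp_add, ← Category.assoc u' (𝟙 y - _), Preadditive.comp_sub u',
        Category.comp_id]
      rcases Finset.mem_insert.1 hu' with rfl | hu'
      · rw [hu]
        abel
      · rw [hs u' hu', sub_self, zero_comp, add_zero]
  obtain ⟨ι, hι, f, g, hfg⟩ := key Finset.univ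
  exact ⟨ι, hι, f, g, fun u ↦ hfg u (Finset.mem_univ _)⟩

variable [HasFiniteBiproducts A]

/-- The biproduct of copies of `t` indexed by `ι`. -/
noncomputable abbrev power (t : A) (ι : Type) [Finite ι] : A := ⨁ fun _ : ι ↦ t

/-- The endomorphism of a power of `t` given by a square matrix. -/
noncomputable def matrixEnd {t : A} {ι : Type} [Fintype ι] (a : Matrix ι ι (End t)) :
    power t ι ⟶ power t ι :=
  biproduct.lift fun i ↦ ∑ j, biproduct.π (fun _ : ι ↦ t) j ≫ (a i j : t ⟶ t)

/-- Morphisms to a power of `t` are tuples of morphisms to `t`. -/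
noncomputable def homPowerEquiv (x t : A) (ι : Type) [Finite ι] :
    (x ⟶ power t ι) ≃ (ι → (x ⟶ t)) where
  toFun u i := u ≫ biproduct.π _ i
  invFun v := biproduct.lift v
  left_inv u := by ext; simp
  right_inv v := by ext; simp

theorem homPowerEquiv_comp_matrixEnd {x t : A} {ι : Type} [Fintype ι] [DecidableEq ι]
    (u : x ⟶ power t ι) (a : Matrix ι ι (End t)) :
    homPowerEquiv x t ι (u ≫ matrixEnd a) = a • homPowerEquiv x t ι u := by
  ext i
  rw [Matrix.Module.smul_apply]
  simp only [homPowerEquiv, matrixEnd, Equiv.coe_fn_mk, Category.assoc, biproduct.lift_π,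
    Preadditive.comp_sum]
  exact Finset.sum_congr rfl fun j _ ↦ (Category.assoc _ _ _).symm

/-- The elements of the monoid algebra carrying `H` into `L` at this power form a two-sided ideal,
by stability of both families. It contains the erasing matrices, which factor through a power with
one factor fewer, hence it contains `X`, which acts as the identity. -/
theorem le_power_of_le_erase {x t : A} {L H : ∀ y : A, Submodule k ((x ⟶ y) →₀ k)}
    (hL : IsStableFamily k L) (hH : IsStableFamily k H)
    {ι : Type} [Fintype ι] [DecidableEq ι] {X : MonoidAlgebra k (Matrix ι ι (End t))}
    (hX : X ∈ singIdeal k (End t) ι) (hX1 : linAct k _ (ι → (x ⟶ t)) X = 1)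
    (h : ∀ j : ι, H (power t {i // i ≠ j}) ≤ L (power t {i // i ≠ j})) :
    H (power t ι) ≤ L (power t ι) := by
  let θ := Finsupp.domLCongr (M := k) (R := k) (homPowerEquiv x t ι)
  have hθ : ∀ (a : Matrix ι ι (End t)) (v : (x ⟶ power t ι) →₀ k),
      linAct k _ _ (MonoidAlgebra.of k _ a) (θ v) =
        θ (Finsupp.mapDomain (· ≫ matrixEnd a) v) := by
    intro a v
    induction v using Finsupp.induction_linear with
    | zero => simp
    | add v w hv hw => rw [map_add, map_add, hv, hw, Finsupp.mapDomain_add, map_add]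
    | single u r =>
      rw [Finsupp.mapDomain_single, Finsupp.domLCongr_single, Finsupp.domLCongr_single,
        linAct_of_single, homPowerEquiv_comp_matrixEnd]
  have hst : ∀ {K : ∀ y : A, Submodule k ((x ⟶ y) →₀ k)}, IsStableFamily k K →
      ∀ (Y : MonoidAlgebra k (Matrix ι ι (End t))) {v : (ι → (x ⟶ t)) →₀ k},
        v ∈ (K (power t ι)).map θ.toLinearMap →
          linAct k _ _ Y v ∈ (K (power t ι)).map θ.toLinearMap := by
    intro K hK Y v hv
    refine linAct_mem_of_forall_of_mem (fun a v hv ↦ ?_) Y hv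
    obtain ⟨v, hv, rfl⟩ := hv
    exact ⟨_, hK (matrixEnd a) v hv, (hθ a v).symm⟩
  let J : TwoSidedIdeal (MonoidAlgebra k (Matrix ι ι (End t))) :=
    .mk' {Y | ∀ v ∈ (H (power t ι)).map θ.toLinearMap,
        linAct k _ _ Y v ∈ (L (power t ι)).map θ.toLinearMap}
      (fun v _ ↦ by simp)
      (fun hx hy v hv ↦ by simpa using add_mem (hx v hv) (hy v hv))
      (fun hx v hv ↦ by simpa using hx v hv)
      (fun {x y} hy v hv ↦ by
        rw [map_mul, Module.End.mul_apply]
        exact hst hL x (hy v hv))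
      (fun {x y} hx v hv ↦ by
        rw [map_mul, Module.End.mul_apply]
        exact hx _ (hst hH y hv))
  have hJ : singIdeal k (End t) ι ≤ J := by
    rw [singIdeal, TwoSidedIdeal.span_le]
    rintro _ ⟨j, rfl⟩
    simp only [J, SetLike.mem_coe, TwoSidedIdeal.mem_mk', Set.mem_ofPred_eq]
    rintro _ ⟨v, hv, rfl⟩
    refine ⟨_, ?_, (hθ _ v).symm⟩
    let r : power t ι ⟶ power t {i // i ≠ j} :=
      biproduct.lift fun i ↦ biproduct.π (fun _ : ι ↦ t) i
    let s : power t {i // i ≠ j} ⟶ power t ι := biproduct.lift fun i ↦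
      if hi : i ≠ j then biproduct.π (fun _ : {i // i ≠ j} ↦ t) ⟨i, hi⟩ else 0
    have hrs : matrixEnd (eraseCoord (End t) j) = r ≫ s := by
      refine biproduct.hom_ext _ _ fun i ↦ ?_
      simp only [matrixEnd, s, biproduct.lift_π, Category.assoc]
      rw [Finset.sum_eq_single i]
      · by_cases hi : i = j
        · subst hi
          simp only [eraseCoord, Matrix.diagonal_apply_eq, if_true, ne_eq, not_true_eq_false,
            dite_false, comp_zero]
        · simp only [eraseCoord, Matrix.diagonal_apply_eq, ne_eq, hi,
            not_false_eq_true, dite_true, r, biproduct.lift_π]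
          exact Category.comp_id _
      · intro l _ hl
        rw [eraseCoord, Matrix.diagonal_apply_ne _ hl.symm]
        exact comp_zero
      · simp
    have := hL s _ (h j (hH r v hv))
    rw [← Finsupp.mapDomain_comp] at this
    have hfun : (· ≫ s) ∘ (· ≫ r) = fun u : x ⟶ power t ι ↦ u ≫ matrixEnd (eraseCoord _ j) := by
      ext u
      simp [hrs]
    rwa [hfun] at this
  intro v hv
  have h1 : θ v ∈ (L (power t ι)).map θ.toLinearMap := by
    have := (TwoSidedIdeal.mem_mk' _ _ _ _ _ _ _).1 (hJ hX) (θ v) ⟨v, hv, rfl⟩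
    rwa [hX1] at this
  obtain ⟨v', hv', h2⟩ := h1
  rwa [θ.injective h2] at hv'

/-- Under a finiteness condition, stable families of subspaces of the spaces `k[A(x, y)]` are
determined by their value on one object. -/
theorem exists_test_object {x t : A} (hA : IsKTrivial A k)
    (h : ∀ (y : A) (u : x ⟶ y), ∃ (ι : Type) (_ : Fintype ι) (f : ι → (y ⟶ t))
      (g : ι → (t ⟶ y)), u ≫ ∑ i, f i ≫ g i = u) :
    ∃ b : A, ∀ L H : ∀ y : A, Submodule k ((x ⟶ y) →₀ k), IsStableFamily k L →
      IsStableFamily k H → H b ≤ L b → ∀ y, H y ≤ L y := by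
  classical
  have : Finite (End t) := (hA t t).1
  have := Fintype.ofFinite (End t)
  have : Finite (x ⟶ t) := (hA x t).1
  have hR : (Fintype.card (End t) : k) ≠ 0 := by
    rw [← Nat.card_eq_fintype_card]
    exact (hA t t).2.ne_zero
  obtain ⟨n, hn⟩ := exists_identity_mem_singIdeal (k := k) (R := End t) (N := (x ⟶ t)) hR
  refine ⟨power t (Fin n), fun L H hL hH hb y ↦ ?_⟩
  have hpow : ∀ (c : ℕ) (ι : Type) [Fintype ι], Fintype.card ι = c →
      H (power t ι) ≤ L (power t ι) := by
    intro c
    induction c with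
    | zero =>
      intro ι _ hc
      have : IsEmpty ι := Fintype.card_eq_zero_iff.1 hc
      refine le_of_factors hL hH (b := power t (Fin n)) 0 0 (fun u ↦ ?_) hb
      exact biproduct.hom_ext _ _ fun i ↦ isEmptyElim i
    | succ c ih =>
      intro ι _ hc
      -- Large powers are reduced by one factor; powers smaller than `n` are retracts of the test
      -- object.
      by_cases hcn : n ≤ c + 1
      · obtain ⟨X, hX, hX1⟩ := hn ι (hc ▸ hcn)
        refine le_power_of_le_erase hL hH hX hX1 fun j ↦ ih _ ?_
        simp [Fintype.card_subtype_compl, hc]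
      · obtain ⟨e⟩ : Nonempty (ι ↪ Fin n) := Function.Embedding.nonempty_of_card_le (by
          rw [hc, Fintype.card_fin]; omega)
        refine le_of_factors hL hH (b := power t (Fin n))
          (biproduct.desc fun i ↦ biproduct.ι (fun _ : Fin n ↦ t) (e i))
          (biproduct.lift fun i ↦ biproduct.π (fun _ : Fin n ↦ t) (e i)) (fun u ↦ ?_) hb
        refine (congrArg (u ≫ ·) ?_).trans (Category.comp_id u)
        ext i j
        by_cases hij : i = j
        · subst hij; simp
        · have : e j ≠ e i := fun h ↦ hij (e.injective h).symm
          simp [biproduct.ι_π_ne _ (Ne.symm hij), biproduct.ι_π_ne _ this]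
  have : Finite (x ⟶ y) := (hA x y).1
  obtain ⟨ι, _, f, g, hfg⟩ := exists_common_factorization (h y)
  exact le_of_factors hL hH (biproduct.lift f) (biproduct.desc g)
    (fun u ↦ by rw [biproduct.lift_desc, hfg]) (hpow _ ι rfl)

end TestObject

/-! ### Finite height in modular lattices. -/

section ModularLattice

instance {I : Type*} {M : I → Type*} [∀ i, Lattice (M i)] [∀ i, IsModularLattice (M i)]
    (S : Sublattice (∀ i, M i)) : IsModularLattice S where
  sup_inf_le_assoc_of_le {_} b {_} h i :=
    IsModularLattice.sup_inf_le_assoc_of_le (b.1 i) (h i)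

/-- An element of a lattice below which both chain conditions hold. -/
def IsFiniteHeight {α : Type*} [Preorder α] (a : α) : Prop :=
  WellFoundedLT (Set.Iic a) ∧ WellFoundedGT (Set.Iic a)

variable {α : Type*} [Lattice α]

theorem IsFiniteHeight.sup [IsModularLattice α] {a b : α} (ha : IsFiniteHeight a)
    (hb : IsFiniteHeight b) : IsFiniteHeight (a ⊔ b) := by
  -- By modularity, comparable elements with the same `z ⊓ a` and `z ⊔ a` coincide. For the same
  -- reason `z ⊔ a` is detected by its meet with `b`, its join with `b` being always `a ⊔ b`.
  let φ : Set.Iic (a ⊔ b) → Set.Iic a × Set.Iic b := fun z ↦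
    (⟨(z : α) ⊓ a, inf_le_right⟩, ⟨((z : α) ⊔ a) ⊓ b, inf_le_right⟩)
  have hφ : StrictMono φ := by
    intro z z' hlt
    have h : (z : α) ≤ z' := hlt.le
    have hle : φ z ≤ φ z' := ⟨inf_le_inf_right a h, inf_le_inf_right b (sup_le_sup_right h a)⟩
    refine lt_of_le_not_ge hle fun hge ↦ hlt.ne (Subtype.ext ?_)
    have h1 : (z' : α) ⊓ a ≤ (z : α) ⊓ a := hge.1
    have h2 : ((z' : α) ⊔ a) ⊓ b ≤ ((z : α) ⊔ a) ⊓ b := hge.2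
    have h3 : (z : α) ⊔ a = (z' : α) ⊔ a := by
      refine eq_of_le_of_inf_le_of_sup_le (z := b) (sup_le_sup_right h a) h2 ?_
      exact sup_le (sup_le (z'.2.trans (sup_le (le_sup_of_le_left le_sup_right) le_sup_right))
        (le_sup_of_le_left le_sup_right)) le_sup_right
    exact eq_of_le_of_inf_le_of_sup_le (z := a) h h1 h3.ge
  have := ha.1
  have := ha.2
  have := hb.1
  have := hb.2
  exact ⟨hφ.wellFoundedLT, hφ.wellFoundedGT⟩

theorem IsFiniteHeight.wellFounded {a : α} (ha : IsFiniteHeight a) (h : ∀ b, b ≤ a) :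
    WellFoundedLT α ∧ WellFoundedGT α := by
  have h' : StrictMono fun b : α ↦ (⟨b, h b⟩ : Set.Iic a) := fun _ _ hlt ↦ hlt
  have := ha.1
  have := ha.2
  exact ⟨h'.wellFoundedLT, h'.wellFoundedGT⟩

end ModularLattice

/-! ### Subfunctors and quotient functors. -/

section StableFamily

variable {A : Type u} [Category.{v} A] {S : Type t} [Ring S]

/-- The lattice of families of submodules of the values of a functor that are stable under its
action on morphisms. -/
def stableFamilies (F : A ⥤ ModuleCat.{w} S) : Sublattice (∀ y, Submodule S (F.obj y)) where
  carrier := {L | ∀ ⦃y z : A⦄ (f : y ⟶ z), L y ≤ (L z).comap (F.map f).hom}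
  supClosed' := fun _ hL _ hH _ _ f ↦
    sup_le ((hL f).trans (Submodule.comap_mono le_sup_left))
      ((hH f).trans (Submodule.comap_mono le_sup_right))
  infClosed' := fun _ hL _ hH _ _ f ↦ le_inf (inf_le_left.trans (hL f)) (inf_le_right.trans (hH f))

variable {F G : A ⥤ ModuleCat.{w} S}

/-- The subfunctor attached to a stable family. -/
def subfunctor (L : stableFamilies F) : A ⥤ ModuleCat.{w} S where
  obj y := ModuleCat.of S (L.1 y)
  map f := ModuleCat.ofHom ((F.map f).hom.restrict fun _ h ↦ L.2 f h)
  map_id y := by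
    ext m
    simp
  map_comp f g := by
    ext m
    simp

/-- The inclusion of a subfunctor. -/
def subfunctorι (L : stableFamilies F) : subfunctor L ⟶ F where
  app y := ModuleCat.ofHom (L.1 y).subtype

/-- The quotient functor attached to a stable family. -/
def quotientFunctor (L : stableFamilies F) : A ⥤ ModuleCat.{w} S where
  obj y := ModuleCat.of S (F.obj y ⧸ L.1 y)
  map f := ModuleCat.ofHom (Submodule.mapQ _ _ (F.map f).hom (L.2 f))
  map_id y := by
    ext m
    simp
  map_comp f g := by
    ext m
    simp

/-- The projection onto a quotient functor. -/
def quotientFunctorπ (L : stableFamilies F) : F ⟶ quotientFunctor L where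
  app y := ModuleCat.ofHom (L.1 y).mkQ

instance (L : stableFamilies F) : Mono (subfunctorι L) := by
  rw [NatTrans.mono_iff_mono_app]
  intro y
  rw [ModuleCat.mono_iff_injective]
  exact Subtype.val_injective

instance (L : stableFamilies F) : Epi (quotientFunctorπ L) := by
  rw [NatTrans.epi_iff_epi_app]
  intro y
  rw [ModuleCat.epi_iff_surjective]
  exact Submodule.mkQ_surjective _

/-- The image of a natural transformation. -/
def rangeFamily (φ : G ⟶ F) : stableFamilies F :=
  ⟨fun y ↦ LinearMap.range (φ.app y).hom, by
    rintro y z f _ ⟨m, rfl⟩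
    exact ⟨G.map f m, NatTrans.naturality_apply φ f m⟩⟩

theorem rangeFamily_comp_le {H : A ⥤ ModuleCat.{w} S} (ψ : H ⟶ G) (φ : G ⟶ F) :
    rangeFamily (ψ ≫ φ) ≤ rangeFamily φ := by
  rintro y _ ⟨m, rfl⟩
  exact ⟨ψ.app y m, rfl⟩

theorem rangeFamily_subfunctorι (L : stableFamilies F) : rangeFamily (subfunctorι L) = L :=
  Subtype.ext (funext fun y ↦ Submodule.range_subtype (L.1 y))

/-- The inclusion between subfunctors. -/
def subfunctorHom {L H : stableFamilies F} (h : L ≤ H) : subfunctor L ⟶ subfunctor H where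
  app y := ModuleCat.ofHom (Submodule.inclusion (h y))

/-- The preimage of a stable family under a natural transformation. -/
def comapFamily (φ : G ⟶ F) (L : stableFamilies F) : stableFamilies G :=
  ⟨fun y ↦ (L.1 y).comap (φ.app y).hom, fun y z f m hm ↦ by
    have : φ.app z (G.map f m) = F.map f (φ.app y m) := NatTrans.naturality_apply φ f m
    change φ.app z (G.map f m) ∈ L.1 z
    rw [this]
    exact L.2 f hm⟩

end StableFamily

/-! ### Finite length and local finiteness, for both categories at once. -/

section Embedded

variable {A : Type u} [Category.{v} A] {S : Type t} [Ring S]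
  {C : Type*} [Category C]

/-- A full subcategory of a functor category that is closed under subobjects and quotients. -/
class IsSubquotientClosed (Φ : C ⥤ (A ⥤ ModuleCat.{w} S)) : Prop where
  full : Φ.Full
  faithful : Φ.Faithful
  sub : ∀ {X : C} {G : A ⥤ ModuleCat.{w} S} (i : G ⟶ Φ.obj X) [Mono i], Φ.essImage G
  quot : ∀ {X : C} {G : A ⥤ ModuleCat.{w} S} (p : Φ.obj X ⟶ G) [Epi p], Φ.essImage G

attribute [instance] IsSubquotientClosed.full IsSubquotientClosed.faithful

variable (Φ : C ⥤ (A ⥤ ModuleCat.{w} S)) [IsSubquotientClosed Φ]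

/-- The kernel of `Φ.map f` is a subobject of `Φ.obj X`, so it comes from `C`, where `f` can be
cancelled. -/
theorem preserves_mono {X Y : C} (f : X ⟶ Y) [Mono f] : Mono (Φ.map f) := by
  apply Preadditive.mono_of_kernel_zero
  obtain ⟨K, ⟨e⟩⟩ := IsSubquotientClosed.sub (kernel.ι (Φ.map f))
  have : Φ.preimage (e.hom ≫ kernel.ι (Φ.map f)) = Φ.preimage 0 := by
    rw [← cancel_mono f]
    apply Φ.map_injective
    simp
  have h2 := congrArg Φ.map this
  rw [Φ.map_preimage, Φ.map_preimage] at h2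
  rw [← cancel_epi e.hom, h2, comp_zero]

theorem rangeFamily_strictMono (X : C) :
    StrictMono fun s : Subobject X ↦ rangeFamily (Φ.map s.arrow) := by
  intro s s' hlt
  have hfac := Subobject.ofLE_arrow hlt.le
  refine lt_of_le_not_ge ?_ fun hge ↦ hlt.not_ge ?_
  · dsimp only
    rw [← hfac, Φ.map_comp]
    exact rangeFamily_comp_le _ _
  · have hm := preserves_mono Φ s'.arrow
    have hm' := preserves_mono Φ (Subobject.ofLE s s' hlt.le)
    have : IsIso (Φ.map (Subobject.ofLE s s' hlt.le)) := by
      rw [NatTrans.isIso_iff_isIso_app]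
      intro y
      have : Mono ((Φ.map (Subobject.ofLE s s' hlt.le)).app y) := inferInstance
      have : Epi ((Φ.map (Subobject.ofLE s s' hlt.le)).app y) := by
        rw [ModuleCat.epi_iff_surjective]
        intro m
        obtain ⟨n, hn⟩ := hge y ⟨m, rfl⟩
        refine ⟨n, ?_⟩
        have hmy : Mono ((Φ.map s'.arrow).app y) := inferInstance
        rw [ModuleCat.mono_iff_injective] at hmy
        apply hmy
        rw [← hfac, Φ.map_comp] at hn
        exact hn
      exact isIso_of_mono_of_epi _
    have := isIso_of_reflects_iso (Subobject.ofLE s s' hlt.le) Φ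
    exact Subobject.le_of_comm (inv (Subobject.ofLE s s' hlt.le)) (by simp)

theorem exists_subobject_strictMono (X : C) :
    ∃ φ : stableFamilies (Φ.obj X) → Subobject X, StrictMono φ := by
  choose K e using fun L : stableFamilies (Φ.obj X) ↦ IsSubquotientClosed.sub (subfunctorι L)
  let e' := fun L ↦ (e L).some
  let j : ∀ L, K L ⟶ X := fun L ↦ Φ.preimage ((e' L).hom ≫ subfunctorι L)
  have hj : ∀ L, Φ.map (j L) = (e' L).hom ≫ subfunctorι L := fun L ↦ Φ.map_preimage _
  have : ∀ L, Mono (j L) := fun L ↦ Φ.mono_of_mono_map (by rw [hj]; infer_instance)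
  refine ⟨fun L ↦ Subobject.mk (j L), fun L H hlt ↦ lt_of_le_not_ge ?_ fun hge ↦ hlt.not_ge ?_⟩
  · refine Subobject.mk_le_mk_of_comm
      (Φ.preimage ((e' L).hom ≫ subfunctorHom hlt.le ≫ (e' H).inv)) (Φ.map_injective ?_)
    rw [Φ.map_comp, Φ.map_preimage, hj, hj]
    simp only [Category.assoc, Iso.inv_hom_id_assoc]
    rfl
  · have h := congrArg Φ.map (Subobject.ofMkLEMk_comp hge)
    rw [Φ.map_comp, hj, hj] at h
    have h2 : subfunctorι H = ((e' H).inv ≫ Φ.map (Subobject.ofMkLEMk _ _ hge) ≫ (e' L).hom) ≫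
        subfunctorι L := by simp [h]
    rw [← rangeFamily_subfunctorι H, h2]
    exact (rangeFamily_comp_le _ _).trans (rangeFamily_subfunctorι L).le

/-- Chain conditions pull back along strictly monotone maps, so one such map in each direction is
enough. -/
theorem isFiniteLength_iff (X : C) : isFiniteLength C X ↔
    WellFoundedLT (stableFamilies (Φ.obj X)) ∧ WellFoundedGT (stableFamilies (Φ.obj X)) := by
  constructor
  · rintro ⟨h1, h2⟩
    obtain ⟨φ, hφ⟩ := exists_subobject_strictMono Φ X
    have : WellFoundedGT (Subobject X) := h1
    have : WellFoundedLT (Subobject X) := h2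
    exact ⟨hφ.wellFoundedLT, hφ.wellFoundedGT⟩
  · rintro ⟨h1, h2⟩
    have hφ := rangeFamily_strictMono Φ X
    exact ⟨hφ.wellFoundedGT, hφ.wellFoundedLT⟩

theorem isLocallyFinite_of_forall_exists
    (h : ∀ x : A, ∃ X : C, isFiniteLength C X ∧ ∃ ξ : (Φ.obj X).obj x,
      ∀ (Y : C) (η : (Φ.obj Y).obj x), ∃ m : X ⟶ Y, (Φ.map m).app x ξ = η) :
    IsLocallyFinite C := by
  intro Y Z f g hfg
  apply Φ.map_injective
  ext x η
  obtain ⟨X, hX, ξ, hξ⟩ := h x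
  obtain ⟨m, rfl⟩ := hξ Y η
  have := congrArg (fun φ ↦ (Φ.map φ).app x ξ) (hfg X hX m)
  simpa using this

/-- Below the image of `φ`, taking preimages is strictly monotone. -/
theorem isFiniteHeight_rangeFamily {X : C} (hX : isFiniteLength C X) {F : A ⥤ ModuleCat.{w} S}
    (φ : Φ.obj X ⟶ F) : IsFiniteHeight (rangeFamily φ) := by
  obtain ⟨_, _⟩ := (isFiniteLength_iff Φ X).1 hX
  have h : StrictMono fun L : Set.Iic (rangeFamily φ) ↦ comapFamily φ L.1 := by
    intro L H hlt
    refine lt_of_le_not_ge (fun y ↦ Submodule.comap_mono (hlt.le y)) fun hge ↦ hlt.not_ge ?_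
    intro y m hm
    obtain ⟨n, rfl⟩ := H.2 y hm
    exact hge y hm
  exact ⟨h.wellFoundedLT, h.wellFoundedGT⟩

/-- The union of the stable families of finite height. -/
def finiteHeightFamily (F : A ⥤ ModuleCat.{w} S) : stableFamilies F :=
  ⟨fun y ↦
    { carrier := {m | ∃ L : stableFamilies F, IsFiniteHeight L ∧ m ∈ L.1 y}
      zero_mem' := ⟨⟨⊥, fun y z f ↦ bot_le⟩, by
        have : Unique (Set.Iic (⟨⊥, fun y z f ↦ bot_le⟩ : stableFamilies F)) :=
          ⟨⟨⟨_, Set.mem_Iic.2 le_rfl⟩⟩, fun L ↦ Subtype.ext (le_antisymm L.2 fun _ ↦ bot_le)⟩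
        exact ⟨inferInstance, inferInstance⟩, zero_mem _⟩
      add_mem' := by
        rintro a b ⟨L, hL, ha⟩ ⟨H, hH, hb⟩
        exact ⟨L ⊔ H, hL.sup hH, add_mem (Submodule.mem_sup_left ha) (Submodule.mem_sup_right hb)⟩
      smul_mem' := by
        rintro c a ⟨L, hL, ha⟩
        exact ⟨L, hL, Submodule.smul_mem _ c ha⟩ },
    fun _ _ f _ ⟨L, hL, ha⟩ ↦ ⟨L, hL, L.2 f ha⟩⟩

/-- In a locally finite category, a functor generated by one element has finite length. -/
theorem isFiniteLength_of_isLocallyFinite (h : IsLocallyFinite C) {X : C} {x : A}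
    (ξ : (Φ.obj X).obj x) (hξ : ∀ L : stableFamilies (Φ.obj X), ξ ∈ L.1 x → ∀ H, H ≤ L) :
    isFiniteLength C X := by
  -- Every map from an object of finite length lands in `M`, so the projection modulo `M` vanishes.
  -- Thus `ξ` lies in a stable family of finite height, which is everything.
  let M := finiteHeightFamily (Φ.obj X)
  obtain ⟨Q, ⟨e⟩⟩ := IsSubquotientClosed.quot (quotientFunctorπ M)
  have h0 : Φ.preimage (quotientFunctorπ M ≫ e.inv) = Φ.preimage 0 := by
    refine h _ _ fun Y hY g ↦ Φ.map_injective ?_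
    rw [Φ.map_comp, Φ.map_comp, Φ.map_preimage, Φ.map_preimage, comp_zero, ← Category.assoc]
    have : Φ.map g ≫ quotientFunctorπ M = 0 := by
      ext y m
      exact (Submodule.Quotient.mk_eq_zero _).2
        ⟨_, isFiniteHeight_rangeFamily Φ hY (Φ.map g), ⟨m, rfl⟩⟩
    rw [this, zero_comp]
  have h1 : quotientFunctorπ M = 0 := by
    have := congrArg Φ.map h0
    rw [Φ.map_preimage, Φ.map_preimage] at this
    rw [← cancel_mono e.inv, this, zero_comp]
  have h2 : (quotientFunctorπ M).app x ξ = 0 := by rw [h1]; rfl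
  obtain ⟨L, hL, hm⟩ := (Submodule.Quotient.mk_eq_zero _).1 h2
  exact (isFiniteLength_iff Φ X).2 (hL.wellFounded (hξ L hm))

end Embedded
-- The generators `k[A(x,-)]`.
section FreeFunctor

variable {A : Type u} [Category.{v} A] [LocallySmall.{w} A]

instance {S : Type t} [Ring S] : IsSubquotientClosed (𝟭 (A ⥤ ModuleCat.{w} S)) where
  full := inferInstance
  faithful := inferInstance
  sub {_ G} _ _ := ⟨G, ⟨Iso.refl _⟩⟩
  quot {_ G} _ _ := ⟨G, ⟨Iso.refl _⟩⟩

/-- Postcomposition on shrunk sets of morphisms. -/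
noncomputable def shrinkComp {x y z : A} (f : y ⟶ z) (a : Shrink.{w} (x ⟶ y)) :
    Shrink.{w} (x ⟶ z) :=
  equivShrink _ ((equivShrink _).symm a ≫ f)

@[simp]
theorem shrinkComp_equivShrink {x y z : A} (f : y ⟶ z) (a : x ⟶ y) :
    shrinkComp.{w} f (equivShrink _ a) = equivShrink _ (a ≫ f) := by
  simp [shrinkComp]

theorem shrinkComp_id {x y : A} : shrinkComp.{w} (x := x) (𝟙 y) = id := by
  ext a
  simp [shrinkComp]

theorem shrinkComp_comp {x y z z' : A} (f : y ⟶ z) (g : z ⟶ z') :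
    shrinkComp.{w} (x := x) (f ≫ g) = shrinkComp g ∘ shrinkComp f := by
  ext a
  simp [shrinkComp]

variable (k : Type w) [Field k]

/-- The functor `k[A(x, -)]`. -/
noncomputable def freeFunctor (x : A) : A ⥤ ModuleCat.{w} k where
  obj y := ModuleCat.of k (Shrink.{w} (x ⟶ y) →₀ k)
  map f := ModuleCat.ofHom (Finsupp.lmapDomain k k (shrinkComp f))
  map_id y := by
    rw [shrinkComp_id, Finsupp.lmapDomain_id]
    rfl
  map_comp f g := by
    rw [shrinkComp_comp, Finsupp.lmapDomain_comp]
    rfl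

/-- The canonical generator of `k[A(x, -)]`. -/
noncomputable def freeFunctorGen (x : A) : (freeFunctor k x).obj x :=
  Finsupp.single (equivShrink _ (𝟙 x)) (1 : k)

variable {k}

theorem freeFunctor_map_gen {x y : A} (f : x ⟶ y) :
    (freeFunctor k x).map f (freeFunctorGen k x) = Finsupp.single (equivShrink _ f) (1 : k) := by
  refine Finsupp.mapDomain_single.trans ?_
  simp

theorem exists_hom_of_freeFunctor {x : A} (F : A ⥤ ModuleCat.{w} k) (η : F.obj x) :
    ∃ m : freeFunctor k x ⟶ F, m.app x (freeFunctorGen k x) = η := by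
  refine ⟨
    { app y := ModuleCat.ofHom
        (Finsupp.linearCombination k fun a ↦ F.map ((equivShrink _).symm a) η)
      naturality y z f := ?_ }, ?_⟩
  · apply ModuleCat.hom_ext
    refine Finsupp.lhom_ext fun a r ↦ ?_
    change Finsupp.linearCombination k _ (Finsupp.mapDomain _ _) =
      F.map f (Finsupp.linearCombination k _ _)
    simp [Finsupp.mapDomain_single, shrinkComp]
  · refine (Finsupp.linearCombination_single k _ _).trans ?_
    simp

theorem le_of_freeFunctorGen_mem {x : A} {L : stableFamilies (freeFunctor k x)}
    (h : freeFunctorGen k x ∈ L.1 x) (H : stableFamilies (freeFunctor k x)) : H ≤ L := by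
  intro y m hm
  clear hm
  change Shrink.{w} (x ⟶ y) →₀ k at m
  change m ∈ L.1 y
  induction m using Finsupp.induction_linear with
  | zero => exact zero_mem _
  | add v w hv hw => exact add_mem hv hw
  | single a r =>
    have h1 : (freeFunctor k x).map ((equivShrink _).symm a) (freeFunctorGen k x) ∈ L.1 y :=
      L.2 ((equivShrink _).symm a) h
    rw [freeFunctor_map_gen, Equiv.apply_symm_apply] at h1
    rw [show Finsupp.single a r = r • Finsupp.single a (1 : k) by simp]
    exact Submodule.smul_mem _ r h1

/-- Evaluation at `b` is strictly monotone, with values in the subspaces of a finite-dimensional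
space. -/
theorem wellFounded_stableFamilies_freeFunctor {x b : A} [Finite (x ⟶ b)]
    (hb : ∀ L H : ∀ y : A, Submodule k ((x ⟶ y) →₀ k),
      IsStableFamily k L → IsStableFamily k H → H b ≤ L b → ∀ y, H y ≤ L y) :
    WellFoundedLT (stableFamilies (freeFunctor k x)) ∧
      WellFoundedGT (stableFamilies (freeFunctor k x)) := by
  let θ : ∀ y, ((x ⟶ y) →₀ k) ≃ₗ[k] (Shrink.{w} (x ⟶ y) →₀ k) := fun y ↦
    Finsupp.domLCongr (equivShrink _)
  have hθ : ∀ {y z : A} (f : y ⟶ z) (v : (x ⟶ y) →₀ k),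
      θ z (Finsupp.mapDomain (· ≫ f) v) = (freeFunctor k x).map f (θ y v) := by
    intro y z f v
    change θ z _ = Finsupp.mapDomain (shrinkComp f) (θ y v)
    induction v using Finsupp.induction_linear with
    | zero => simp
    | add v w hv hw => rw [Finsupp.mapDomain_add, map_add, hv, hw, map_add, Finsupp.mapDomain_add]
    | single u r => simp [θ, Finsupp.mapDomain_single]
  let c : stableFamilies (freeFunctor k x) → ∀ y : A, Submodule k ((x ⟶ y) →₀ k) :=
    fun L y ↦ (L.1 y).comap (θ y).toLinearMap
  have hc : ∀ L, IsStableFamily k (c L) := by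
    intro L y z f v hv
    change θ z (Finsupp.mapDomain (· ≫ f) v) ∈ L.1 z
    rw [hθ]
    exact L.2 f hv
  have hmono : StrictMono fun L : stableFamilies (freeFunctor k x) ↦ L.1 b := by
    intro L H hlt
    refine lt_of_le_not_ge (hlt.le b) fun hge ↦ hlt.not_ge fun y m hm ↦ ?_
    obtain ⟨v, rfl⟩ := (θ y).surjective m
    exact hb (c L) (c H) (hc L) (hc H) (Submodule.comap_mono hge) y hm
  have : Module.Finite k ((freeFunctor k x).obj b) :=
    inferInstanceAs (Module.Finite k (Shrink.{w} (x ⟶ b) →₀ k))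
  exact ⟨hmono.wellFoundedLT, hmono.wellFoundedGT⟩

theorem isLocallyFinite_of_wellFounded_freeFunctor
    (h : ∀ x : A, WellFoundedLT (stableFamilies (freeFunctor k x)) ∧
      WellFoundedGT (stableFamilies (freeFunctor k x))) : IsLocallyFinite (FunctorCat A k) :=
  isLocallyFinite_of_forall_exists (𝟭 _) fun x ↦
    ⟨freeFunctor k x, (isFiniteLength_iff (𝟭 _) _).2 (h x), freeFunctorGen k x,
      fun Y η ↦ exists_hom_of_freeFunctor Y η⟩

variable (k) in
theorem isLocallyFinite_functorCat_iff :
    IsLocallyFinite (FunctorCat A k) ↔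
      ∀ x : A, WellFoundedLT (stableFamilies (freeFunctor k x)) ∧
        WellFoundedGT (stableFamilies (freeFunctor k x)) :=
  ⟨fun h x ↦ (isFiniteLength_iff (𝟭 _) _).1
    (isFiniteLength_of_isLocallyFinite (𝟭 _) h (freeFunctorGen k x)
      fun _ hL ↦ le_of_freeFunctorGen_mem hL), isLocallyFinite_of_wellFounded_freeFunctor⟩

end FreeFunctor

/-! ### Finite length forces detection by one object. -/

section Generated

variable {A : Type u} [Category.{v} A] {S : Type t} [Ring S] {F : A ⥤ ModuleCat.{w} S}

theorem le_of_retract {L H : stableFamilies F} {s b : A} (i : s ⟶ b) (p : b ⟶ s)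
    (hip : i ≫ p = 𝟙 s) (h : H.1 b ≤ L.1 b) : H.1 s ≤ L.1 s := by
  intro m hm
  have h1 : F.map p (F.map i m) ∈ L.1 s := L.2 p (h (H.2 i hm))
  rwa [← ConcreteCategory.comp_apply, ← F.map_comp, hip, F.map_id] at h1

/-- If the lattice of stable families satisfies both chain conditions, then stable families are
determined by their value at one object. -/
theorem exists_determining_object [Preadditive A] [HasBinaryBiproducts A] [Nonempty A]
    [WellFoundedLT (stableFamilies F)] [WellFoundedGT (stableFamilies F)] :
    ∃ b : A, ∀ L H : stableFamilies F, H.1 b ≤ L.1 b → H ≤ L := by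
  have key : ∀ N : stableFamilies F, ∃ b : A, ∀ L H : stableFamilies F, L ≤ H → H ≤ N →
      H.1 b ≤ L.1 b → H ≤ L := by
    intro N
    induction N using WellFoundedLT.induction with
    | ind N ih =>
    by_cases hN : ∃ N₀, N₀ < N
    -- `N₁` is maximal below `N`, so the quotient is simple. The object `b` detects families inside
    -- `N₁`, and `s` detects whether a family leaves `N₁`; modularity combines the two.
    · obtain ⟨N₁, hN₁, hmax⟩ := WellFounded.has_min
        (wellFounded_gt (α := stableFamilies F)) {N₁ | N₁ < N} hN
      have hN₁ : N₁ < N := hN₁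
      have hsup : ∀ K ≤ N, ¬ K ≤ N₁ → K ⊔ N₁ = N := fun K hK hK' ↦ by
        by_contra hne
        refine hmax (K ⊔ N₁) (lt_of_le_of_ne (sup_le hK hN₁.le) hne) ?_
        exact lt_of_le_not_ge le_sup_right fun h ↦ hK' (le_sup_left.trans h)
      obtain ⟨b, hb⟩ := ih N₁ hN₁
      obtain ⟨s, hs⟩ : ∃ s, ¬ N.1 s ≤ N₁.1 s := by
        by_contra! h
        exact hN₁.not_ge h
      refine ⟨b ⊞ s, fun L H hLH hHN h ↦ ?_⟩
      have h1 : H.1 b ≤ L.1 b := le_of_retract biprod.inl biprod.fst (by simp) h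
      have h2 : H.1 s ≤ L.1 s := le_of_retract biprod.inr biprod.snd (by simp) h
      have h3 : H ⊓ N₁ ≤ L ⊓ N₁ := hb _ _ (inf_le_inf_right _ hLH) inf_le_right
        (inf_le_inf_right (N₁.1 b) h1)
      by_cases hH : H ≤ N₁
      · exact (le_inf le_rfl hH).trans (h3.trans inf_le_left)
      · have hL : ¬ L ≤ N₁ := by
          intro hL
          refine hs ?_
          rw [← hsup H hHN hH]
          exact sup_le (h2.trans (hL s)) le_rfl
        exact (eq_of_le_of_inf_le_of_sup_le hLH h3
          ((hsup H hHN hH).trans (hsup L (hLH.trans hHN) hL).symm).le).ge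
    · refine ⟨Classical.arbitrary A, fun L H hLH hHN _ ↦ ?_⟩
      by_contra hle
      exact hN ⟨L, (lt_of_le_not_ge hLH hle).trans_le hHN⟩
  obtain ⟨b, hb⟩ := key ⟨⊤, fun _ _ _ _ _ ↦ trivial⟩
  refine ⟨b, fun L H h ↦ ?_⟩
  -- Replacing `L` by `L ⊓ H` gives the inclusion required by `key`.
  exact (hb (L ⊓ H) H inf_le_right (fun _ ↦ le_top) (le_inf h le_rfl)).trans inf_le_left

end Generated

/-! ### Additive functors and the generators `A(x,-)`. -/

section Additive

variable {A : Type u} [Category.{v} A] [Preadditive A]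

/-- Additive functors to abelian groups, viewed as functors to `ℤ`-modules. -/
def repToModule : Rep.{w} A ⥤ (A ⥤ ModuleCat.{w} ℤ) where
  obj F :=
    { obj y := ModuleCat.of ℤ (F.obj.obj y)
      map f := ModuleCat.ofHom (F.obj.map f).hom.toIntLinearMap
      map_id y := by ext m; simp
      map_comp f g := by ext m; simp }
  map φ :=
    { app y := ModuleCat.ofHom (φ.hom.app y).hom.toIntLinearMap
      naturality y z f := by
        ext m
        exact NatTrans.naturality_apply φ.hom f m }

instance (F : Rep.{w} A) : (repToModule.obj F).Additive where
  map_add {y z f g} := by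
    ext m
    exact ConcreteCategory.congr_hom (F.obj.map_add (f := f) (g := g)) m

theorem essImage_repToModule (G : A ⥤ ModuleCat.{w} ℤ) [G.Additive] :
    repToModule.essImage G := by
  refine ⟨AdditiveFunctor.of (G ⋙ forget₂ (ModuleCat ℤ) AddCommGrpCat), ⟨?_⟩⟩
  refine NatIso.ofComponents
    (fun y ↦ LinearEquiv.toModuleIso (AddEquiv.refl (G.obj y)).toIntLinearEquiv) ?_
  intro y z f
  ext m
  rfl

instance : IsSubquotientClosed (repToModule.{w} (A := A)) where
  full := ⟨fun {F G} ψ ↦ ⟨⟨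
    { app y := AddCommGrpCat.ofHom (ψ.app y).hom.toAddMonoidHom
      naturality y z f := by
        ext m
        exact NatTrans.naturality_apply ψ f m }⟩, rfl⟩⟩
  faithful := ⟨fun {F G} φ ψ h ↦ by
    ext y m
    exact congrArg (fun χ ↦ χ.app y m) h⟩
  sub {X G} i _ := by
    have : G.Additive := ⟨fun {y z f g} ↦ by
      rw [← cancel_mono (i.app z)]
      simp only [Preadditive.add_comp, NatTrans.naturality, Functor.map_add, Preadditive.comp_add]⟩
    exact essImage_repToModule G
  quot {X G} p _ := by
    have : G.Additive := ⟨fun {y z f g} ↦ by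
      rw [← cancel_epi (p.app y)]
      simp only [Preadditive.comp_add, ← NatTrans.naturality, Functor.map_add,
        Preadditive.add_comp]⟩
    exact essImage_repToModule G

variable [LocallySmall.{w} A]

/-- The additive functor `A(x, -)`. -/
noncomputable def homFunctor (x : A) : A ⥤ AddCommGrpCat.{w} where
  obj y := AddCommGrpCat.of (Shrink.{w} (x ⟶ y))
  map f := AddCommGrpCat.ofHom
    (AddMonoidHom.mk' (shrinkComp f) fun a b ↦ by
      simp [shrinkComp, equivShrink_symm_add, equivShrink_add])
  map_id y := by
    ext a
    exact congrArg (equivShrink _).symm (congrFun shrinkComp_id a)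
  map_comp f g := by
    ext a
    exact congrArg (equivShrink _).symm (congrFun (shrinkComp_comp f g) a)

instance (x : A) : (homFunctor.{w} x).Additive where
  map_add {y z f g} := by
    ext a
    change shrinkComp (f + g) a = shrinkComp f a + shrinkComp g a
    simp [shrinkComp, equivShrink_add]

/-- The object of `Rep A` corepresented by `x`. -/
noncomputable def homRep (x : A) : Rep.{w} A := AdditiveFunctor.of (homFunctor x)

/-- The canonical generator of `A(x, -)`. -/
noncomputable def homRepGen (x : A) : (repToModule.obj (homRep.{w} x)).obj x :=
  equivShrink _ (𝟙 x)

theorem homRep_map_equivShrink {x y z : A} (u : x ⟶ y) (f : y ⟶ z) :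
    (repToModule.obj (homRep.{w} x)).map f (equivShrink (x ⟶ y) u : Shrink.{w} (x ⟶ y)) =
      (equivShrink (x ⟶ z) (u ≫ f) : Shrink.{w} (x ⟶ z)) :=
  shrinkComp_equivShrink f u

theorem exists_hom_of_homRep {x : A} (F : Rep.{w} A) (η : (repToModule.obj F).obj x) :
    ∃ m : homRep x ⟶ F, (repToModule.map m).app x (homRepGen x) = η := by
  refine ⟨⟨
    { app y := AddCommGrpCat.ofHom
        (AddMonoidHom.mk' (fun a : Shrink.{w} (x ⟶ y) ↦ F.obj.map ((equivShrink _).symm a) η)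
          fun a b ↦ by
            rw [equivShrink_symm_add, F.obj.map_add]
            rfl)
      naturality y z f := ?_ }⟩, ?_⟩
  · ext a
    change F.obj.map ((equivShrink _).symm (shrinkComp f a)) η =
      F.obj.map f (F.obj.map ((equivShrink _).symm a) η)
    simp [shrinkComp]
    rfl
  · change F.obj.map ((equivShrink _).symm (equivShrink _ (𝟙 x))) η = η
    simp
    rfl

theorem le_of_homRepGen_mem {x : A} {L : stableFamilies (repToModule.obj (homRep.{w} x))}
    (h : homRepGen x ∈ L.1 x) (H : stableFamilies (repToModule.obj (homRep.{w} x))) :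
    H ≤ L := by
  intro y m _
  obtain ⟨u, rfl⟩ := (equivShrink.{w} (x ⟶ y)).surjective m
  have h1 : (repToModule.obj (homRep.{w} x)).map u (homRepGen x) ∈ L.1 y := L.2 u h
  rw [homRepGen, homRep_map_equivShrink, Category.id_comp] at h1
  exact h1

theorem isLocallyFinite_rep_iff : IsLocallyFinite (Rep.{w} A) ↔
    ∀ x : A, WellFoundedLT (stableFamilies (repToModule.obj (homRep.{w} x))) ∧
      WellFoundedGT (stableFamilies (repToModule.obj (homRep.{w} x))) := by
  refine ⟨fun h x ↦ (isFiniteLength_iff repToModule _).1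
    (isFiniteLength_of_isLocallyFinite repToModule h (homRepGen x)
      fun L hL ↦ le_of_homRepGen_mem hL), fun h ↦ ?_⟩
  exact isLocallyFinite_of_forall_exists repToModule fun x ↦
    ⟨homRep x, (isFiniteLength_iff repToModule _).2 (h x), homRepGen x,
      fun Y η ↦ exists_hom_of_homRep Y η⟩

/-- The subspace spanned by a set of basis vectors remembers that set. -/
theorem exists_strictMono_to_freeFunctor (k : Type w) [Field k] (x : A) :
    ∃ φ : stableFamilies (repToModule.obj (homRep.{w} x)) → stableFamilies (freeFunctor k x),
      StrictMono φ := by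
  refine ⟨fun N ↦ ⟨fun y ↦ Finsupp.supported k k {a : Shrink.{w} (x ⟶ y) | a ∈ N.1 y},
    fun y z f ↦ ?_⟩, fun N M hlt ↦ ?_⟩
  · refine le_trans ?_ (Finsupp.supported_comap_lmapDomain k k (shrinkComp f) _)
    exact Finsupp.supported_mono fun a ha ↦ N.2 f ha
  · refine lt_of_le_not_ge (fun y ↦ Finsupp.supported_mono (hlt.le y)) fun hge ↦
      hlt.not_ge fun y a ha ↦ ?_
    have h1 : Finsupp.single a (1 : k) ∈
        Finsupp.supported k k {a : Shrink.{w} (x ⟶ y) | a ∈ N.1 y} :=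
      hge y (Finsupp.single_mem_supported k 1 ha)
    by_contra hna
    exact one_ne_zero (Finsupp.single_eq_same.symm.trans ((Finsupp.mem_supported' k _).1 h1 a hna))

/-- The family of all `u ≫ ∑ i, f i ≫ g i` where `f i ≫ g i` factors through `b`. -/
noncomputable def factorFamily {x y : A} (u : x ⟶ y) (b : A) :
    stableFamilies (repToModule.obj (homRep.{w} x)) :=
  ⟨fun z ↦ AddSubgroup.toIntSubmodule
    { carrier := {a : Shrink.{w} (x ⟶ z) | ∃ (ι : Type) (_ : Fintype ι) (f : ι → (y ⟶ b))
        (g : ι → (b ⟶ z)), equivShrink _ (u ≫ ∑ i, f i ≫ g i) = a}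
      zero_mem' := ⟨Empty, inferInstance, nofun, nofun, by
        simp
        rfl⟩
      add_mem' := by
        rintro _ _ ⟨ι, _, f, g, rfl⟩ ⟨ι', _, f', g', rfl⟩
        refine ⟨ι ⊕ ι', inferInstance, Sum.elim f f', Sum.elim g g', ?_⟩
        simp [Fintype.sum_sum_type, equivShrink_add]
        rfl
      neg_mem' := by
        rintro _ ⟨ι, _, f, g, rfl⟩
        refine ⟨ι, inferInstance, f, fun i ↦ -g i, ?_⟩
        simp [equivShrink_neg]
        rfl },
    by
      rintro z z' h _ ⟨ι, _, f, g, rfl⟩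
      refine ⟨ι, inferInstance, f, fun i ↦ g i ≫ h, ?_⟩
      refine Eq.trans ?_ (homRep_map_equivShrink _ h).symm
      simp only [Category.assoc, Preadditive.sum_comp]⟩

/-- The family of all `u ≫ f`. -/
noncomputable def cyclicFamily {x y : A} (u : x ⟶ y) :
    stableFamilies (repToModule.obj (homRep.{w} x)) :=
  ⟨fun z ↦ AddSubgroup.toIntSubmodule
    { carrier := {a : Shrink.{w} (x ⟶ z) | ∃ f : y ⟶ z, equivShrink _ (u ≫ f) = a}
      zero_mem' := ⟨0, by simp; rfl⟩
      add_mem' := by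
        rintro _ _ ⟨f, rfl⟩ ⟨f', rfl⟩
        exact ⟨f + f', by simp [equivShrink_add]; rfl⟩
      neg_mem' := by
        rintro _ ⟨f, rfl⟩
        exact ⟨-f, by simp [equivShrink_neg]; rfl⟩ },
    by
      rintro z z' h _ ⟨f, rfl⟩
      refine ⟨f ≫ h, Eq.trans ?_ (homRep_map_equivShrink _ h).symm⟩
      simp only [Category.assoc]⟩

/-- At a determining object `b`, every `u ≫ f` trivially factors through `b`. So the subfunctor
generated by `u` lies in the family of morphisms `u ≫ ∑ i, f i ≫ g i`; evaluating at `𝟙 y` gives the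
claim. -/
theorem exists_factorization_object [HasBinaryBiproducts A] (x : A)
    [WellFoundedLT (stableFamilies (repToModule.obj (homRep.{w} x)))]
    [WellFoundedGT (stableFamilies (repToModule.obj (homRep.{w} x)))] :
    ∃ b : A, ∀ (y : A) (u : x ⟶ y), ∃ (ι : Type) (_ : Fintype ι) (f : ι → (y ⟶ b))
      (g : ι → (b ⟶ y)), u ≫ ∑ i, f i ≫ g i = u := by
  have : Nonempty A := ⟨x⟩
  obtain ⟨b, hb⟩ := exists_determining_object (F := repToModule.obj (homRep.{w} x))
  refine ⟨b, fun y u ↦ ?_⟩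
  have h1 : (cyclicFamily.{w} u).1 b ≤ (factorFamily u b).1 b := by
    rintro _ ⟨f, rfl⟩
    exact ⟨Unit, inferInstance, fun _ ↦ f, fun _ ↦ 𝟙 b, by simp⟩
  obtain ⟨ι, hι, f, g, h⟩ := hb _ _ h1 y ⟨𝟙 y, rfl⟩
  exact ⟨ι, hι, f, g, by simpa using (equivShrink _).injective h⟩

end Additive

theorem isLocallyFinite_functorCat_of_exists {A : Type u} [Category.{v} A] [Preadditive A]
    [HasFiniteBiproducts A] [LocallySmall.{w} A] {k : Type w} [Field k] (hA : IsKTrivial A k)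
    (h : ∀ x : A, ∃ b : A, ∀ (y : A) (u : x ⟶ y), ∃ (ι : Type) (_ : Fintype ι)
      (f : ι → (y ⟶ b)) (g : ι → (b ⟶ y)), u ≫ ∑ i, f i ≫ g i = u) :
    IsLocallyFinite (FunctorCat A k) := by
  refine isLocallyFinite_of_wellFounded_freeFunctor fun x ↦ ?_
  obtain ⟨t, ht⟩ := h x
  obtain ⟨b, hb⟩ := exists_test_object hA ht
  have := (hA x b).1
  exact wellFounded_stableFamilies_freeFunctor hb

theorem isLocallyFinite_functorCat_iff_rep {A : Type u} [Category.{v} A] [Preadditive A]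
    [HasFiniteBiproducts A] [LocallySmall.{w} A] {k : Type w} [Field k] (hA : IsKTrivial A k) :
    IsLocallyFinite (FunctorCat A k) ↔ IsLocallyFinite (Rep.{w} A) := by
  constructor
  · intro h
    rw [isLocallyFinite_rep_iff]
    intro x
    obtain ⟨_, _⟩ := (isLocallyFinite_functorCat_iff k).1 h x
    obtain ⟨φ, hφ⟩ := exists_strictMono_to_freeFunctor k x
    exact ⟨hφ.wellFoundedLT, hφ.wellFoundedGT⟩
  · intro h
    refine isLocallyFinite_functorCat_of_exists hA fun x ↦ ?_
    obtain ⟨_, _⟩ := isLocallyFinite_rep_iff.1 h x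
    have := hasBinaryBiproducts_of_finite_biproducts A
    exact exists_factorization_object.{w} x

/-! ### Finitely generated projective modules. -/

section ProjectiveModules

variable (R : Type t) [Ring R]

theorem projCat_hom_ext_sum {x y : ProjCat R} {ι : Type} [Fintype ι] {f : ι → (x ⟶ y)}
    {g : x ⟶ y} (h : ∀ m : x.obj, ∑ i, (f i).hom m = g.hom m) : ∑ i, f i = g := by
  apply (isFGProjective R).ι.map_injective
  rw [Functor.map_sum]
  ext m
  rw [ModuleCat.hom_sum, LinearMap.sum_apply]
  exact h m

instance : HasFiniteBiproducts (ProjCat R) where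
  out n :=
    { has_biproduct F := by
        have h1 : ∀ j, Module.Finite R (F j).obj := fun j ↦ (F j).property.1
        have h2 : ∀ j, Module.Projective R (F j).obj := fun j ↦ (F j).property.2
        let b : Bicone F :=
          { pt := ⟨ModuleCat.of R (∀ j, (F j).obj), inferInstanceAs (Module.Finite R (∀ j, _)),
              Module.Projective.of_equiv
                (DFinsupp.linearEquivFunOnFintype (R := R) (M := fun j ↦ (F j).obj))⟩
            π j := ObjectProperty.homMk (ModuleCat.ofHom (LinearMap.proj j))
            ι j := ObjectProperty.homMk (ModuleCat.ofHom
              (LinearMap.single R (fun j ↦ ((F j).obj : Type t)) j))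
            ι_π j j' := by
              split_ifs with h
              · subst h
                ext m
                simp
              · ext m
                exact Pi.single_eq_of_ne' (M := fun j ↦ ((F j).obj : Type t)) h m }
        refine hasBiproduct_of_total b (projCat_hom_ext_sum R fun m ↦ ?_)
        exact Finset.univ_sum_single (M := fun j ↦ ((F j).obj : Type t)) m }

/-- The regular module, as a finitely generated projective module. -/
def regularModule : ProjCat R :=
  ⟨ModuleCat.of R R, inferInstanceAs (Module.Finite R R), inferInstanceAs (Module.Projective R R)⟩

theorem exists_factorization_regularModule (y : ProjCat R) :
    ∃ (n : ℕ) (f : Fin n → (y ⟶ regularModule R)) (g : Fin n → (regularModule R ⟶ y)),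
      ∑ i, f i ≫ g i = 𝟙 y := by
  have := y.property.1
  have := y.property.2
  obtain ⟨n, p, s, hp, -, hs⟩ := Module.Finite.exists_comp_eq_id_of_projective R y.obj
  refine ⟨n, fun i ↦ ObjectProperty.homMk (ModuleCat.ofHom (LinearMap.proj i ∘ₗ s)),
    fun i ↦ ObjectProperty.homMk (ModuleCat.ofHom (p ∘ₗ LinearMap.single R (fun _ ↦ R) i)), ?_⟩
  refine projCat_hom_ext_sum R fun m ↦ ?_
  change ∑ i, p (Pi.single i (s m i)) = m
  rw [← map_sum, Finset.univ_sum_single]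
  exact LinearMap.congr_fun hs m

end ProjectiveModules

end GenericRep

theorem mainTheorem6 (k : Type w) [Field k] :
    (∀ (A : Type u) [Category.{v} A] [Preadditive A] [HasFiniteBiproducts A]
        [EssentiallySmall.{w} A], GenericRep.IsKTrivial A k →
        (GenericRep.IsLocallyFinite (GenericRep.FunctorCat A k) ↔
          GenericRep.IsLocallyFinite (GenericRep.Rep.{w} A))) ∧
    (∀ (R : Type t) [Ring R], GenericRep.IsKTrivialRing R k →
        GenericRep.IsLocallyFinite (GenericRep.FunctorCat (GenericRep.ProjCat R) k)) := by
  refine ⟨fun A _ _ _ _ hA ↦ GenericRep.isLocallyFinite_functorCat_iff_rep hA, fun R _ hR ↦ ?_⟩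
  have hA := (GenericRep.isKTrivialRing_iff R k).1 hR
  -- Finite sets of morphisms are small in every universe, so `R` and `k` may live in unrelated
  -- ones.
  have : LocallySmall.{w} (GenericRep.ProjCat R) := ⟨fun x y ↦ by
    have := (hA x y).1
    infer_instance⟩
  refine GenericRep.isLocallyFinite_functorCat_of_exists hA fun x ↦
    ⟨GenericRep.regularModule R, fun y u ↦ ?_⟩
  obtain ⟨n, f, g, h⟩ := GenericRep.exists_factorization_regularModule R y
  exact ⟨Fin n, inferInstance, f, g, by rw [h, Category.comp_id]⟩
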